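/- Let $\Bbbk$ be a field, and order $\mathbb{R}^n$ by the product order. A persistence module over a poset $P$ is a functor $\mathbb{M}$ from $P$ to $\Bbbk$-vector spaces, with structure maps $\rho_s^t:\mathbb{M}_s\to\mathbb{M}_t$ for $s\le t$; it is pfd if every $\mathbb{M}_t$ is finite-dimensional. A submodule of $\mathbb{M}$ is a family of subspaces $N_t\subseteq \mathbb{M}_t$ preserved by all $\rho_s^t$. **Strong exactness.** A persistence module $N$ over $\mathbb{R}^2$ is 2-parameter strongly exact if for all $(x_1,x_2)\le(y_1,y_2)$ the sequence $$N_{(x_1,x_2)}\xrightarrow{(\rho,\rho)}N_{(x_1,y_2)}\oplus N_{(y_1,x_2)}\xrightarrow{\rho-\rho}N_{(y_1,y_2)}$$ is exact at the middle term. For $x\le y$ in $\mathbb{R}^3$ let $\mathcal X$ be the cube of spaces $\mathcal X(T)$, $T\subseteq S=\{1,2,3\}$, where $\mathcal X(T)$ is $\mathbb{M}$ at the point with $i$-th coordinate $y_i$ if $i\in T$ and $x_i$ otherwise. A persistence module $\mathbb{M}$ over $\mathbb{R}^3$ is 3-parameter strongly exact if its restrictions to all planes $\{t_i=r\}$ ($i=1,2,3$,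 $r\in\mathbb{R}$) are 2-parameter strongly exact and, for all $x\le y$, the natural map $\psi:\mathcal X(\emptyset)\to\lim_{T\neq\emptyset}\mathcal X(T)$ is surjective and the natural map $\varphi:\operatorname{colim}_{T\ne S}\mathcal X(T)\to\mathcal X(S)$ is injective. **Blocks.** A cut $c=(c^-,c^+)$ is a partition of $\mathbb{R}$ into two (possibly empty) sets with $x<y$ for all $x\in c^-$, $y\in c^+$. Cuts $c_i,c^i$ ($i=1,2,3$) determine the cuboid $\prod_{i=1}^3 (c_i^+\cap (c^i)^-)\subseteq\mathbb{R}^3$. Let $\mathcal B_i$ ($i=1,2,3$) be the set of strict $i$-layer blocks, i.e. the cuboids given by cuts with $c_j^-=(c^j)^+=\emptyset$ for $j\neq i$ and $c_i^-\neq\emptyset\neq (c^i)^+$, and let $\mathcal B_5$ be the set of birth blocks, i.e. the cuboids given by cuts with $(c^1)^+=(c^2)^+=(c^3)^+=\emptyset$ (so $\mathbb{R}^3\in\mathcal B_5$). **Subspaces.** For $C\subseteq\mathbb{R}^3$ and $t\in\mathbb{R}^3$ put $$I^+_{C,t}=\bigcap_{s\in C,\,s\le t}\operatorname{Im}\rho_s^t,\quad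 I^-_{C,t}=\sum_{s\notin C,\,s\le t}\operatorname{Im}\rho_s^t,\quad K^+_{C,t}=\bigcap_{u\notin C,\,u\ge t}\operatorname{Ker}\rho_t^u,\quad K^-_{C,t}=\sum_{u\in C,\,u\ge t}\operatorname{Ker}\rho_t^u,$$ (an empty intersection is $\mathbb{M}_t$), and $$\mathrm{Im}^+_{C,t}=I^+_{C,t},\quad \mathrm{Im}^-_{C,t}=I^-_{C,t}\cap I^+_{C,t},\quad \mathrm{Ker}^+_{C,t}=K^+_{C,t}+K^-_{C,t},\quad \mathrm{Ker}^-_{C,t}=K^-_{C,t},$$ $$V^+_{C,t}=\mathrm{Im}^+_{C,t}\cap\mathrm{Ker}^+_{C,t},\qquad V^-_{C,t}=\mathrm{Im}^+_{C,t}\cap\mathrm{Ker}^-_{C,t}+\mathrm{Im}^-_{C,t}\cap\mathrm{Ker}^+_{C,t}.$$ For a block $B$ let $V^\pm_B=\varprojlim_{t\in B}V^\pm_{B,t}$, i.e. the space of all families $(x_t)_{t\in B}$ with $x_t\in V^\pm_{B,t}$ and $\rho_s^t(x_s)=x_t$ for $s\le t$ in $B$, with projections $\pi_t$. An admissible complement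 for $B$ is a subspace $M_B^0$ with $V_B^+=V_B^-\oplus M_B^0$ such that the family $(\mathbb{M}_B)_t=\pi_t(M_B^0)$ for $t\in B$, $(\mathbb{M}_B)_t=0$ for $t\notin B$, is a submodule $\mathbb{M}_B$ of $\mathbb{M}$. Finally, let $\tilde{\mathbb{M}}_t=\mathrm{Im}^+_{\mathbb{R}^3,t}\cap\mathrm{Ker}^-_{\mathbb{R}^3,t}$. **Statement.** Let $\mathbb{M}$ be a pfd, 3-parameter strongly exact persistence module over $\mathbb{R}^3$. Then every $B\in\mathcal B_1\cup\mathcal B_2\cup\mathcal B_3\cup\mathcal B_5$ has an admissible complement, and for every choice of admissible complements $M_B^0$, $\tilde{\mathbb{M}}$ and the $\mathbb{M}_B$ are submodules of $\mathbb{M}$ and $$\mathbb{M}=\tilde{\mathbb{M}}\oplus\bigoplus_{B\in\mathcal B_1\cup\mathcal B_2\cup\mathcal B_3\cup\mathcal B_5}\mathbb{M}_B$$ as an internal direct sum, i.e. $\mathbb{M}_t=\tilde{\mathbb{M}}_t\oplus\bigoplus_B(\mathbb{M}_B)_t$ for every $t\in\mathbb{R}^3$. -/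

import Mathlib

open CategoryTheory CategoryTheory.Limits

universe u w v v'

/-- A persistence module over a preorder `P`: a functor from `P` to `k`-vector spaces. -/
abbrev PersistenceModule (k : Type u) [Field k] (P : Type v) [Preorder P] :=
  P ⥤ ModuleCat.{w} k

namespace PersistenceModule

section General

variable {k : Type u} [Field k] {P : Type v} [Preorder P] {Q : Type v'} [Preorder Q]

/-- The vector space `M_t`. -/
abbrev space (M : PersistenceModule.{u, w} k P) (t : P) : ModuleCat.{w} k := M.obj t

/-- The structure map `ρ_s^t : M_s → M_t`. -/
def rho (M : PersistenceModule.{u, w} k P) {s t : P} (h : s ≤ t) : M.space s →ₗ[k] M.space t :=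
  (M.map (homOfLE h)).hom

/-- The module `M ∘ f` over `Q`, for a monotone map `f : Q → P`. -/
def restrict (M : PersistenceModule.{u, w} k P) (f : Q →o P) : PersistenceModule.{u, w} k Q :=
  f.monotone.functor ⋙ M

/-- Pointwise finite-dimensional. -/
def IsPfd (M : PersistenceModule.{u, w} k P) : Prop :=
  ∀ t : P, FiniteDimensional k (M.space t)

/-- A family of subspaces `N_t ⊆ M_t` is a (persistence) submodule if it is preserved by all
structure maps. -/
def IsPersistenceSubmodule (M : PersistenceModule.{u, w} k P)
    (N : (t : P) → Submodule k (M.space t)) : Prop :=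
  ∀ (s t : P) (h : s ≤ t), (N s).map (M.rho h) ≤ N t

open Classical in
/-- `M` is the internal direct sum of the family of its submodules `N i` (direct sums of
persistence modules are pointwise). -/
def IsInternalDirectSum (M : PersistenceModule.{u, w} k P) {ι : Type*}
    (N : ι → (t : P) → Submodule k (M.space t)) : Prop :=
  (∀ i, M.IsPersistenceSubmodule (N i)) ∧
    ∀ t : P, DirectSum.IsInternal (fun i => N i t)

/-- `I⁺_{C,t}`, the intersection of the images of `ρ_s^t` over `s ∈ C`, `s ≤ t`. -/
def imInter (M : PersistenceModule.{u, w} k P) (C : Set P) (t : P) : Submodule k (M.space t) :=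
  ⨅ (s : P) (_ : s ∈ C) (h : s ≤ t), LinearMap.range (M.rho h)

/-- `I⁻_{C,t}`, the sum of the images of `ρ_s^t` over `s ∉ C`, `s ≤ t`. -/
def imSum (M : PersistenceModule.{u, w} k P) (C : Set P) (t : P) : Submodule k (M.space t) :=
  ⨆ (s : P) (_ : s ∉ C) (h : s ≤ t), LinearMap.range (M.rho h)

/-- `K⁺_{C,t}`, the intersection of the kernels of `ρ_t^u` over `u ∉ C`, `t ≤ u`. -/
def kerInter (M : PersistenceModule.{u, w} k P) (C : Set P) (t : P) : Submodule k (M.space t) :=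
  ⨅ (u : P) (_ : u ∉ C) (h : t ≤ u), LinearMap.ker (M.rho h)

/-- `K⁻_{C,t}`, the sum of the kernels of `ρ_t^u` over `u ∈ C`, `t ≤ u`. -/
def kerSum (M : PersistenceModule.{u, w} k P) (C : Set P) (t : P) : Submodule k (M.space t) :=
  ⨆ (u : P) (_ : u ∈ C) (h : t ≤ u), LinearMap.ker (M.rho h)

/-- `Im⁺_{C,t}` -/
def imPlus (M : PersistenceModule.{u, w} k P) (C : Set P) (t : P) : Submodule k (M.space t) :=
  M.imInter C t

/-- `Im⁻_{C,t}` -/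
def imMinus (M : PersistenceModule.{u, w} k P) (C : Set P) (t : P) : Submodule k (M.space t) :=
  M.imSum C t ⊓ M.imInter C t

/-- `Ker⁺_{C,t}` -/
def kerPlus (M : PersistenceModule.{u, w} k P) (C : Set P) (t : P) : Submodule k (M.space t) :=
  M.kerInter C t ⊔ M.kerSum C t

/-- `Ker⁻_{C,t}` -/
def kerMinus (M : PersistenceModule.{u, w} k P) (C : Set P) (t : P) : Submodule k (M.space t) :=
  M.kerSum C t

/-- `V⁺_{C,t} = Im⁺ ∩ Ker⁺` -/
def vPlus (M : PersistenceModule.{u, w} k P) (C : Set P) (t : P) : Submodule k (M.space t) :=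
  M.imPlus C t ⊓ M.kerPlus C t

/-- `V⁻_{C,t} = Im⁺ ∩ Ker⁻ + Im⁻ ∩ Ker⁺` -/
def vMinus (M : PersistenceModule.{u, w} k P) (C : Set P) (t : P) : Submodule k (M.space t) :=
  (M.imPlus C t ⊓ M.kerMinus C t) ⊔ (M.imMinus C t ⊓ M.kerPlus C t)

/-- The inverse limit over `t ∈ C` of subspaces `V_t ⊆ M_t`, as the space of families
`(x_t)_{t ∈ C}` with `x_t ∈ V_t` and `ρ_s^t x_s = x_t`. The projections `π_t` are evaluations. -/
def limitOver (M : PersistenceModule.{u, w} k P) (C : Set P)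
    (V : (t : P) → Submodule k (M.space t)) : Submodule k ((t : C) → M.space t.1) where
  carrier := {x | (∀ t : C, x t ∈ V t.1) ∧
    ∀ (s t : C) (h : s.1 ≤ t.1), M.rho h (x s) = x t}
  add_mem' := by
    rintro x y ⟨hx, hx'⟩ ⟨hy, hy'⟩
    exact ⟨fun t => (V t.1).add_mem (hx t) (hy t), fun s t h => by
      simp [hx' s t h, hy' s t h]⟩
  zero_mem' := ⟨fun t => (V t.1).zero_mem, fun s t h => by simp⟩
  smul_mem' := by
    rintro c x ⟨hx, hx'⟩
    exact ⟨fun t => (V t.1).smul_mem c (hx t), fun s t h => by simp [hx' s t h]⟩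

/-- `V⁺_C(M)`, the inverse limit of the `V⁺_{C,t}`. -/
def limVPlus (M : PersistenceModule.{u, w} k P) (C : Set P) :
    Submodule k ((t : C) → M.space t.1) :=
  M.limitOver C (M.vPlus C)

/-- `V⁻_C(M)`, the inverse limit of the `V⁻_{C,t}`. -/
def limVMinus (M : PersistenceModule.{u, w} k P) (C : Set P) :
    Submodule k ((t : C) → M.space t.1) :=
  M.limitOver C (M.vMinus C)

open Classical in
/-- The family `(M_B)_t = π_t(M_B⁰)` for `t ∈ B`, and `0` for `t ∉ B`. -/
noncomputable def blockPart (M : PersistenceModule.{u, w} k P) (B : Set P)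
    (M0 : Submodule k ((t : B) → M.space t.1)) (t : P) : Submodule k (M.space t) :=
  if h : t ∈ B then
    M0.map (LinearMap.proj (R := k) (φ := fun t : B => M.space t.1) ⟨t, h⟩)
  else ⊥

/-- `M0` is an admissible choice of `M_B⁰`: a complement of `V⁻_B(M)` in `V⁺_B(M)` for which the
family `M_B` is a submodule of `M`. -/
structure IsBlockComplement (M : PersistenceModule.{u, w} k P) (B : Set P)
    (M0 : Submodule k ((t : B) → M.space t.1)) : Prop where
  inf_eq : M0 ⊓ M.limVMinus B = ⊥
  sup_eq : M0 ⊔ M.limVMinus B = M.limVPlus B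
  isSubmodule : M.IsPersistenceSubmodule (M.blockPart B M0)

/-- `M̃_t = Im⁺_{P,t} ∩ Ker⁻_{P,t}`, where `P` is the whole index poset. -/
def tilde (M : PersistenceModule.{u, w} k P) (t : P) : Submodule k (M.space t) :=
  M.imPlus Set.univ t ⊓ M.kerMinus Set.univ t

end General

section Exactness

variable {k : Type u} [Field k]

theorem pair_le {a b c d : ℝ} (h₁ : a ≤ c) (h₂ : b ≤ d) : ![a, b] ≤ ![c, d] := by
  simp [Pi.le_def, Fin.forall_fin_two, h₁, h₂]

/-- The four points of the rectangle between `x` and `y` are `(x₁,x₂)`, `(x₁,y₂)`, `(y₁,x₂)`,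
`(y₁,y₂)`; 2-parameter strong exactness is exactness of
`N_(x₁,x₂) → N_(x₁,y₂) ⊕ N_(y₁,x₂) → N_(y₁,y₂)` for all `x ≤ y`. The maps are
`a ↦ (ρ a, ρ a)` and `(b, c) ↦ ρ b - ρ c`. -/
def StronglyExact₂ (N : PersistenceModule.{u, w} k (Fin 2 → ℝ)) : Prop :=
  ∀ (x₁ x₂ y₁ y₂ : ℝ) (h₁ : x₁ ≤ y₁) (h₂ : x₂ ≤ y₂),
    Function.Exact
      (fun a : N.space ![x₁, x₂] =>
        ((N.rho (pair_le le_rfl h₂) a, N.rho (pair_le h₁ le_rfl) a) :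
          N.space ![x₁, y₂] × N.space ![y₁, x₂]))
      (fun p : N.space ![x₁, y₂] × N.space ![y₁, x₂] =>
        (N.rho (pair_le h₁ le_rfl) p.1 - N.rho (pair_le le_rfl h₂) p.2 : N.space ![y₁, y₂]))

/-- The inclusion of the plane `{t ∈ ℝ³ | t_i = r}`: `r` is inserted as `i`-th coordinate. -/
def planeInclusion (i : Fin 3) (r : ℝ) : (Fin 2 → ℝ) →o (Fin 3 → ℝ) where
  toFun t := i.insertNth r t
  monotone' := by
    intro s t h
    exact Fin.insertNth_le_iff.2 ⟨by simp, fun j => by simpa using h j⟩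

/-- The vertices of the cube between `x` and `y`, indexed by the subsets `T` of the set of
coordinates: `i`-th coordinate `y_i` for `i ∈ T` and `x_i` for `i ∉ T`. -/
def cubeVertex {x y : Fin 3 → ℝ} (h : x ≤ y) : Finset (Fin 3) →o (Fin 3 → ℝ) where
  toFun T := fun i => if i ∈ T then y i else x i
  monotone' := by
    intro S T hST i
    by_cases h1 : i ∈ S
    · simp [h1, hST h1]
    · by_cases h2 : i ∈ T
      · simpa [h1, h2] using h i
      · simp [h1, h2]

/-- For a cube `X`, the natural map `ψ : X(∅) → lim_{T ≠ ∅} X(T)`. -/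
noncomputable def psi (X : PersistenceModule.{u, w} k (Finset (Fin 3))) :
    X.obj ∅ ⟶ limit (X.restrict (OrderHom.Subtype.val (fun T : Finset (Fin 3) => T ≠ ∅))) :=
  limit.lift (X.restrict (OrderHom.Subtype.val (fun T : Finset (Fin 3) => T ≠ ∅)))
    { pt := X.obj ∅
      π :=
        { app := fun T => X.map (homOfLE (Finset.empty_subset T.1))
          naturality := fun S T f => by
            exact (Category.id_comp _).trans
              (X.map_comp (homOfLE (Finset.empty_subset S.1)) (homOfLE (leOfHom f))) } }

/-- For a cube `X` on a set `S` of three elements, the natural map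
`φ : colim_{T ≠ S} X(T) → X(S)`. -/
noncomputable def phi (X : PersistenceModule.{u, w} k (Finset (Fin 3))) :
    colimit (X.restrict (OrderHom.Subtype.val (fun T : Finset (Fin 3) => T ≠ Finset.univ))) ⟶
      X.obj Finset.univ :=
  colimit.desc (X.restrict (OrderHom.Subtype.val (fun T : Finset (Fin 3) => T ≠ Finset.univ)))
    { pt := X.obj Finset.univ
      ι :=
        { app := fun T => X.map (homOfLE (Finset.subset_univ T.1))
          naturality := fun S T f => by
            exact (X.map_comp (homOfLE (leOfHom f)) (homOfLE (Finset.subset_univ T.1))).symm.trans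
              (Category.comp_id _).symm } }

/-- 3-parameter strong exactness. -/
structure StronglyExact₃ (M : PersistenceModule.{u, w} k (Fin 3 → ℝ)) : Prop where
  planes : ∀ (i : Fin 3) (r : ℝ), StronglyExact₂ (M.restrict (planeInclusion i r))
  psi_surjective : ∀ (x y : Fin 3 → ℝ) (h : x ≤ y),
    Function.Surjective (psi (M.restrict (cubeVertex h))).hom
  phi_injective : ∀ (x y : Fin 3 → ℝ) (h : x ≤ y),
    Function.Injective (phi (M.restrict (cubeVertex h))).hom

end Exactness

end PersistenceModule

/-- A cut of the real line: a partition into a lower part `c⁻` and an upper part `c⁺`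
(either may be empty) with every element of `c⁻` strictly below every element of `c⁺`. -/
structure RealCut where
  lower : Set ℝ
  upper : Set ℝ
  isCompl : IsCompl lower upper
  lt_of_mem : ∀ x ∈ lower, ∀ y ∈ upper, x < y

/-- The cuboid `∏_i (c_i⁺ ∩ (c^i)⁻)`, where `c i` stands for `c_i` and `d i` for `c^i`. -/
def cuboid (c d : Fin 3 → RealCut) : Set (Fin 3 → ℝ) :=
  {t | ∀ i, t i ∈ (c i).upper ∩ (d i).lower}

/-- The strict `i`-layer blocks. -/
def IsLayerBlock (i : Fin 3) (B : Set (Fin 3 → ℝ)) : Prop :=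
  ∃ c d : Fin 3 → RealCut, B = cuboid c d ∧
    (∀ j, j ≠ i → (c j).lower = ∅ ∧ (d j).upper = ∅) ∧
    (c i).lower ≠ ∅ ∧ (d i).upper ≠ ∅

/-- The birth blocks (among them the whole space). -/
def IsBirthBlock (B : Set (Fin 3 → ℝ)) : Prop :=
  ∃ c d : Fin 3 → RealCut, B = cuboid c d ∧ ∀ j, (d j).upper = ∅

/-- The blocks that are of layer type or of birth type. -/
abbrev LayerOrBirthBlock : Type :=
  {B : Set (Fin 3 → ℝ) // (∃ i, IsLayerBlock i B) ∨ IsBirthBlock B}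

/-! Strong exactness reduces everything at a point `t` to one-parameter data in the three coordinate
directions. Exact squares paste, so every square `s ⊓ t, s, t, s ⊔ t` is exact in the middle
(`MidExact.all`). Hence an image at `t` is the intersection of its three coordinate images, a kernel
is the sum of its three coordinate kernels, and the kernel in direction `i` lies in every image in a
direction `j ≠ i` (`kr_update_le_img_update`). Injectivity of `φ` adds that the three coordinate
images satisfy the distributive law (`img_update_dist`).

For a cuboid `B` these facts give `V⁺ ∩ (I⁻ + K⁻) ≤ V⁻` (`vPlus_inf_le_vMinus`), and therefore
structure maps inside `B` reflect membership in `V⁻`. If at most one upper cut of `B` is proper,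
then `V⁺ = (I⁺ ∩ K⁺) + V⁻`, and the spaces `I⁺ ∩ K⁺` form an inverse system with surjective maps.
Finite dimensionality makes its limit surject onto every term. A complement chosen inside this limit
is admissible, because families in `K⁺` die on leaving `B`. Every admissible complement then maps at
each `t ∈ B` isomorphically onto a complement of `V⁻` in `V⁺`.

Independence is a triangularity argument. Order the blocks through `t` by how little of them lies
below `t` and how much lies above. In a vanishing sum, all summands other than that of a maximal
block `B` lie in `I⁻ + K⁻` for `B`, so the summand of `B` lies in `V⁻` and is zero.

Spanning is an induction on dimension. An element of a coordinate kernel and a coordinate image lies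
in `tilde` or in `V⁺` of a layer block; an element of an arbitrary image lies in `V⁺` of a birth
block. Modulo the span, the `V⁻` remainder splits into elements of strictly smaller kernels or
images (`kr_inf_img_le`, `img_le`). -/

namespace PersistenceModule

/-! ### Images, kernels and exact squares over a lattice. -/

section Basic

variable {k : Type u} [Field k] {P : Type v} [Preorder P] (M : PersistenceModule.{u, w} k P)

theorem rho_rho {a b c : P} (h : a ≤ b) (h' : b ≤ c) (x : M.space a) :
    M.rho h' (M.rho h x) = M.rho (h.trans h') x := by
  have : M.map (homOfLE (h.trans h')) = M.map (homOfLE h) ≫ M.map (homOfLE h') := by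
    rw [← M.map_comp]; rfl
  simp [rho, this]

theorem rho_refl {a : P} (h : a ≤ a) (x : M.space a) : M.rho h x = x := by
  have : M.map (homOfLE h) = 𝟙 _ := M.map_id a
  simp [rho]

theorem range_rho_mono {a b c : P} (h : a ≤ b) (h' : b ≤ c) :
    LinearMap.range (M.rho (h.trans h')) ≤ LinearMap.range (M.rho h') := by
  rintro _ ⟨x, rfl⟩
  exact ⟨M.rho h x, M.rho_rho h h' x⟩

theorem ker_rho_mono {a b c : P} (h : a ≤ b) (h' : b ≤ c) :
    LinearMap.ker (M.rho h) ≤ LinearMap.ker (M.rho (h.trans h')) := by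
  intro x hx
  rw [LinearMap.mem_ker] at hx ⊢
  rw [← M.rho_rho h h', hx, map_zero]

end Basic

section Lattice

variable {k : Type u} [Field k] {P : Type v} [Lattice P] (M : PersistenceModule.{u, w} k P)

/-- The image in `M_t` of `M_s`, or rather of `M_(s ⊓ t)`. -/
def img (s t : P) : Submodule k (M.space t) := LinearMap.range (M.rho (inf_le_right : s ⊓ t ≤ t))

/-- The kernel of `M_t → M_(u ⊔ t)`. -/
def kr (u t : P) : Submodule k (M.space t) := LinearMap.ker (M.rho (le_sup_right : t ≤ u ⊔ t))

theorem img_eq_range {s t r : P} (h : r ≤ t) (hr : r = s ⊓ t) :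
    M.img s t = LinearMap.range (M.rho h) := by
  subst hr; rfl

theorem kr_eq_ker {u t r : P} (h : t ≤ r) (hr : r = u ⊔ t) :
    M.kr u t = LinearMap.ker (M.rho h) := by
  subst hr; rfl

theorem img_of_le {s t : P} (h : s ≤ t) : M.img s t = LinearMap.range (M.rho h) :=
  M.img_eq_range h (by simp [h])

theorem kr_of_le {u t : P} (h : t ≤ u) : M.kr u t = LinearMap.ker (M.rho h) :=
  M.kr_eq_ker h (by simp [h])

theorem img_mono {s s' : P} (t : P) (h : s ≤ s') : M.img s t ≤ M.img s' t :=
  M.range_rho_mono (inf_le_inf_right t h) inf_le_right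

theorem kr_mono {u u' : P} (t : P) (h : u ≤ u') : M.kr u t ≤ M.kr u' t :=
  M.ker_rho_mono le_sup_right (sup_le_sup_right h t)

theorem img_eq_top {s t : P} (h : t ≤ s) : M.img s t = ⊤ := by
  rw [M.img_eq_range le_rfl (by simp [h]), LinearMap.range_eq_top]
  exact fun x => ⟨x, M.rho_refl _ x⟩

theorem kr_eq_bot {u t : P} (h : u ≤ t) : M.kr u t = ⊥ := by
  rw [M.kr_eq_ker le_rfl (by simp [h]), LinearMap.ker_eq_bot']
  exact fun x hx => by rwa [M.rho_refl] at hx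

/-- The square `s ⊓ t, s, t, s ⊔ t` is exact in the middle. -/
def MidExact (s t : P) : Prop :=
  ∀ (a : M.space s) (b : M.space t), M.rho le_sup_left a = M.rho le_sup_right b →
    ∃ c : M.space (s ⊓ t), M.rho inf_le_left c = a ∧ M.rho inf_le_right c = b

variable {M}

theorem MidExact.exists_lift {s t p q : P} (H : M.MidExact s t) (hp : p = s ⊓ t) (hq : q = s ⊔ t)
    (hps : p ≤ s) (hpt : p ≤ t) (hsq : s ≤ q) (htq : t ≤ q) {a : M.space s} {b : M.space t}
    (h : M.rho hsq a = M.rho htq b) : ∃ c : M.space p, M.rho hps c = a ∧ M.rho hpt c = b := by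
  subst hp hq
  exact H a b h

theorem MidExact.symm {s t : P} (H : M.MidExact s t) : M.MidExact t s := by
  intro a b h
  obtain ⟨c, hc, hc'⟩ := H.exists_lift (inf_comm t s) (sup_comm t s) inf_le_right inf_le_left
    le_sup_right le_sup_left h.symm
  exact ⟨c, hc', hc⟩

theorem MidExact.of_le {s t : P} (h : s ≤ t) : M.MidExact s t := by
  intro a b hab
  have h1 : s ≤ s ⊓ t := le_inf le_rfl h
  have h2 : s ⊔ t ≤ t := sup_le h le_rfl
  refine ⟨M.rho h1 a, by rw [M.rho_rho, M.rho_refl], ?_⟩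
  have := congrArg (M.rho h2) hab
  simp only [M.rho_rho, M.rho_refl] at this
  rw [M.rho_rho, this]

end Lattice
end PersistenceModule

/-! ### Consequences of strong exactness: reduction to coordinate directions, distributivity. -/

namespace PersistenceModule

section Space

variable {k : Type u} [Field k] {M : PersistenceModule.{u, w} k (Fin 3 → ℝ)}

/-- Within a plane, two points are either comparable, where exactness is automatic, or opposite
corners of a rectangle, where it is the hypothesis. -/
theorem MidExact.of_plane (hM : M.StronglyExact₃) (i : Fin 3) {s t : Fin 3 → ℝ} (h : s i = t i) :
    M.MidExact s t := by
  have key : ∀ (x₁ x₂ y₁ y₂ : ℝ), x₁ ≤ y₁ → x₂ ≤ y₂ → ∀ s t : Fin 3 → ℝ,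
      s = i.insertNth (s i) ![x₁, y₂] → t = i.insertNth (s i) ![y₁, x₂] → M.MidExact s t := by
    intro x₁ x₂ y₁ y₂ h₁ h₂ s t hs ht
    generalize s i = r at hs ht
    subst hs ht
    have hp : i.insertNth r ![x₁, x₂] = (i.insertNth r ![x₁, y₂] ⊓ i.insertNth r ![y₁, x₂] :
        Fin 3 → ℝ) := by
      ext j
      refine Fin.succAboveCases i ?_ (fun j => ?_) j
      · simp
      · fin_cases j <;> simp [h₁, h₂]
    have hq : i.insertNth r ![y₁, y₂] = (i.insertNth r ![x₁, y₂] ⊔ i.insertNth r ![y₁, x₂] :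
        Fin 3 → ℝ) := by
      ext j
      refine Fin.succAboveCases i ?_ (fun j => ?_) j
      · simp
      · fin_cases j <;> simp [h₁, h₂]
    have hex := hM.planes i r x₁ x₂ y₁ y₂ h₁ h₂
    intro a b hab
    have hpa : (i.insertNth r ![x₁, x₂] : Fin 3 → ℝ) ≤ i.insertNth r ![x₁, y₂] :=
      hp.le.trans inf_le_left
    have hpb : (i.insertNth r ![x₁, x₂] : Fin 3 → ℝ) ≤ i.insertNth r ![y₁, x₂] :=
      hp.le.trans inf_le_right
    have haq : (i.insertNth r ![x₁, y₂] : Fin 3 → ℝ) ≤ i.insertNth r ![y₁, y₂] :=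
      le_sup_left.trans hq.ge
    have hbq : (i.insertNth r ![y₁, x₂] : Fin 3 → ℝ) ≤ i.insertNth r ![y₁, y₂] :=
      le_sup_right.trans hq.ge
    have hab' : M.rho haq a - M.rho hbq b = 0 := by
      rw [← M.rho_rho le_sup_left hq.ge, ← M.rho_rho le_sup_right hq.ge, hab, sub_self]
    obtain ⟨c, hca, hcb⟩ : ∃ c : M.space (i.insertNth r ![x₁, x₂]),
        M.rho hpa c = a ∧ M.rho hpb c = b := by
      obtain ⟨c, hc⟩ := (hex (a, b)).1 hab'
      exact ⟨c, congrArg Prod.fst hc, congrArg Prod.snd hc⟩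
    refine ⟨M.rho hp.le c, ?_, ?_⟩
    · rw [M.rho_rho, hca]
    · rw [M.rho_rho, hcb]
  have hins : ∀ t : Fin 3 → ℝ, t = i.insertNth (t i) ![t (i.succAbove 0), t (i.succAbove 1)] := by
    intro t
    ext j
    refine Fin.succAboveCases i ?_ (fun j => ?_) j
    · simp
    · fin_cases j <;> simp
  rcases le_total (s (i.succAbove 0)) (t (i.succAbove 0)) with h₀ | h₀ <;>
    rcases le_total (s (i.succAbove 1)) (t (i.succAbove 1)) with h₁ | h₁
  · apply MidExact.of_le
    rw [hins s, hins t, h, Fin.insertNth_le_iff]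
    exact ⟨by simp, fun j => by fin_cases j <;> simp [h₀, h₁]⟩
  · exact key _ _ _ _ h₀ h₁ s t (hins s) (h ▸ hins t)
  · exact (key _ _ _ _ h₀ h₁ t s (hins t) (h ▸ hins s)).symm
  · refine (MidExact.of_le ?_).symm
    rw [hins s, hins t, h, Fin.insertNth_le_iff]
    exact ⟨by simp, fun j => by fin_cases j <;> simp [h₀, h₁]⟩

/-- Of the three coordinates, two must compare in the same direction. The square is then cut into
two squares whose incomparable corners share a coordinate, and exactness of both pastes together. -/
theorem MidExact.all (hM : M.StronglyExact₃) (s t : Fin 3 → ℝ) : M.MidExact s t := by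
  -- one coordinate separates the other two
  have key : ∀ (j l : Fin 3), j ≠ l → ∀ s t : Fin 3 → ℝ, t j ≤ s j → t l ≤ s l →
      M.MidExact s t := by
    intro j l hjl s t hj hl a b hab
    -- The point `f` agrees with `s` in coordinate `j`, and `s ⊓ f` agrees with `t` in coordinate
    -- `l`; moreover `s ⊔ f = s ⊔ t` and `(s ⊓ f) ⊔ t = f`.
    set f : Fin 3 → ℝ := Function.update (s ⊔ t) l (t l) with hf
    have htf : t ≤ f := by
      intro m
      by_cases hm : m = l
      · subst hm; simp [hf]
      · simp [hf, hm]
    have hfq : f ≤ s ⊔ t := by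
      intro m
      by_cases hm : m = l
      · subst hm; simp [hf]
      · simp [hf, hm]
    have h₁ : M.MidExact s f := MidExact.of_plane hM j (by simp [hf, hjl, hj])
    have h₂ : M.MidExact (s ⊓ f) t := MidExact.of_plane hM l (by simp [hf, hl])
    obtain ⟨c, hc, hc'⟩ := h₁.exists_lift rfl
      (le_antisymm (sup_le le_sup_left (htf.trans le_sup_right)) (sup_le le_sup_left hfq))
      inf_le_left inf_le_right le_sup_left hfq (a := a) (b := M.rho htf b) (by rw [M.rho_rho, hab])
    have hp : s ⊓ t = s ⊓ f ⊓ t := by rw [inf_assoc, inf_eq_right.2 htf]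
    have hq : f = s ⊓ f ⊔ t := by
      ext m
      by_cases hm : m = l
      · subst hm; simp [hf]
      · simp [hf, hm]
    obtain ⟨d, hd, hd'⟩ := h₂.exists_lift hp hq
      (inf_le_inf_left s htf) inf_le_right inf_le_right htf hc'
    exact ⟨d, by rw [← hc, ← hd, M.rho_rho], hd'⟩
  rcases le_total (s 0) (t 0) with h₀ | h₀ <;> rcases le_total (s 1) (t 1) with h₁ | h₁ <;>
    rcases le_total (s 2) (t 2) with h₂ | h₂
  · exact (key 0 1 (by decide) t s h₀ h₁).symm
  · exact (key 0 1 (by decide) t s h₀ h₁).symm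
  · exact (key 0 2 (by decide) t s h₀ h₂).symm
  · exact key 1 2 (by decide) s t h₁ h₂
  · exact (key 1 2 (by decide) t s h₁ h₂).symm
  · exact key 0 2 (by decide) s t h₀ h₂
  · exact key 0 1 (by decide) s t h₀ h₁
  · exact key 0 1 (by decide) s t h₀ h₁

theorem img_inf_img_of_sup_eq (hM : M.StronglyExact₃) {s s' t : Fin 3 → ℝ} (h : s ⊔ s' = t) :
    M.img s t ⊓ M.img s' t = M.img (s ⊓ s') t := by
  have hs : s ≤ t := h ▸ le_sup_left
  have hs' : s' ≤ t := h ▸ le_sup_right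
  refine le_antisymm ?_ (le_inf (M.img_mono t inf_le_left) (M.img_mono t inf_le_right))
  rw [M.img_of_le hs, M.img_of_le hs', M.img_of_le (inf_le_left.trans hs)]
  rintro _ ⟨⟨a, rfl⟩, ⟨b, hb⟩⟩
  obtain ⟨c, hc, -⟩ := (MidExact.all hM s s').exists_lift rfl h.symm inf_le_left inf_le_right hs hs'
    hb.symm
  exact ⟨c, by rw [← hc, M.rho_rho]⟩

theorem kr_sup_kr_of_inf_eq (hM : M.StronglyExact₃) {u u' t : Fin 3 → ℝ} (h : u ⊓ u' = t) :
    M.kr u t ⊔ M.kr u' t = M.kr (u ⊔ u') t := by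
  have hu : t ≤ u := h ▸ inf_le_left
  have hu' : t ≤ u' := h ▸ inf_le_right
  refine le_antisymm (sup_le (M.kr_mono t le_sup_left) (M.kr_mono t le_sup_right)) ?_
  rw [M.kr_of_le hu, M.kr_of_le hu', M.kr_of_le (hu.trans le_sup_left)]
  intro x hx
  obtain ⟨c, hc, hc'⟩ := (MidExact.all hM u u').exists_lift h.symm rfl hu hu' le_sup_left
    le_sup_right (a := M.rho hu x) (b := 0) (by rw [M.rho_rho, map_zero]; exact hx)
  refine Submodule.mem_sup.2 ⟨x - c, ?_, c, hc', by simp⟩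
  rw [LinearMap.mem_ker, map_sub, hc, sub_self]

/-- Raise coordinate `i` and lower coordinate `j` of `t` to get `v`. An element of the kernel and `0
∈ M_v` agree at `t ⊔ v`, so exactness lifts them to `t ⊓ v`, which differs from `t` only in
coordinate `j`. -/
theorem kr_update_le_img_update (hM : M.StronglyExact₃) {i j : Fin 3} (hij : i ≠ j)
    (t : Fin 3 → ℝ) (r r' : ℝ) :
    M.kr (Function.update t i r) t ≤ M.img (Function.update t j r') t := by
  intro x hx
  set v := Function.update (Function.update t i r ⊔ t) j (min r' (t j)) with hv
  have hp : Function.update t j r' ⊓ t = t ⊓ v := by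
    ext m
    by_cases hm : m = j
    · subst hm; simp [hv]
    · simp [hv, hm]
  have hq : Function.update t i r ⊔ t = t ⊔ v := by
    ext m
    by_cases hm : m = j
    · subst hm; simp [hv, hij.symm]
    · simp [hv, hm]
  obtain ⟨c, hc, -⟩ := (MidExact.all hM t v).exists_lift hp hq inf_le_right
    (hp.le.trans inf_le_right) le_sup_right (le_sup_right.trans hq.ge) (a := x) (b := 0)
    (by rw [map_zero]; exact hx)
  exact ⟨c, hc⟩

theorem img_inf_self (s t : Fin 3 → ℝ) : M.img (s ⊓ t) t = M.img s t :=
  M.img_eq_range inf_le_right (by simp)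

theorem kr_sup_self (u t : Fin 3 → ℝ) : M.kr (u ⊔ t) t = M.kr u t :=
  M.kr_eq_ker le_sup_right (by simp)

/-- For `s ≤ t`, two coordinate modifications of `t` have join `t`, so exactness turns the
intersection of their images into the image from their meet. The dual statement for kernels is
`kr_eq_iSup`. -/
theorem mem_img_iff (hM : M.StronglyExact₃) {s t : Fin 3 → ℝ} {x : M.space t} :
    x ∈ M.img s t ↔ ∀ i, x ∈ M.img (Function.update t i (s i)) t := by
  have of_le : ∀ s ≤ t, M.img s t = M.img (Function.update t 0 (s 0)) t ⊓
      M.img (Function.update t 1 (s 1)) t ⊓ M.img (Function.update t 2 (s 2)) t := by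
    intro s hs
    rw [img_inf_img_of_sup_eq hM, img_inf_img_of_sup_eq hM]
    · congr 1
      ext m
      have := hs m
      fin_cases m <;> simp_all
    all_goals
      ext m
      have := hs m
      fin_cases m <;> simp_all
  have hi : ∀ i, M.img (Function.update t i ((s ⊓ t) i)) t = M.img (Function.update t i (s i)) t := by
    intro i
    rw [← img_inf_self (Function.update t i (s i))]
    congr 1
    ext m
    by_cases hm : m = i
    · subst hm; simp
    · simp [hm]
  rw [← img_inf_self, of_le _ inf_le_right, hi, hi, hi]
  simp [Fin.forall_fin_succ, and_assoc]

theorem kr_eq_iSup (hM : M.StronglyExact₃) (u t : Fin 3 → ℝ) :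
    M.kr u t = ⨆ i, M.kr (Function.update t i (u i)) t := by
  have of_le : ∀ u, t ≤ u → M.kr u t = M.kr (Function.update t 0 (u 0)) t ⊔
      M.kr (Function.update t 1 (u 1)) t ⊔ M.kr (Function.update t 2 (u 2)) t := by
    intro u hu
    rw [kr_sup_kr_of_inf_eq hM, kr_sup_kr_of_inf_eq hM]
    · congr 1
      ext m
      have := hu m
      fin_cases m <;> simp_all
    all_goals
      ext m
      have := hu m
      fin_cases m <;> simp_all
  have hi : ∀ i, M.kr (Function.update t i ((u ⊔ t) i)) t = M.kr (Function.update t i (u i)) t := by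
    intro i
    rw [← kr_sup_self (Function.update t i (u i))]
    congr 1
    ext m
    by_cases hm : m = i
    · subst hm; simp
    · simp [hm]
  rw [← kr_sup_self, of_le _ le_sup_right, hi, hi, hi]
  refine le_antisymm (sup_le (sup_le ?_ ?_) ?_) (iSup_le fun i => ?_)
  · exact le_iSup (fun i => M.kr (Function.update t i (u i)) t) 0
  · exact le_iSup (fun i => M.kr (Function.update t i (u i)) t) 1
  · exact le_iSup (fun i => M.kr (Function.update t i (u i)) t) 2
  · fin_cases i
    · exact le_sup_left.trans le_sup_left
    · exact le_sup_right.trans le_sup_left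
    · exact le_sup_right

theorem finset_fin_three_facts : ∀ i j l : Fin 3, i ≠ j → j ≠ l → i ≠ l →
    ({i, l} : Finset (Fin 3)) ≠ Finset.univ ∧
      (∀ T : Finset (Fin 3), T ⊆ {i, l} → T ≠ {i, l} → T ⊆ {l} ∨ T ⊆ {i}) ∧
      (∀ T : Finset (Fin 3), {i, l} ⊆ T → T ≠ Finset.univ → T = {i, l}) ∧
      ({j, l} : Finset (Fin 3)) ≠ {i, l} := by
  decide

/-- A relation `a = b + d` at the top vertex already holds in the colimit over the proper faces, by
injectivity of `φ`. A cocone that sees only the vertex `{i, l}` then forces the image of `a` into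
`R`. -/
theorem cubeVertex_dist (hM : M.StronglyExact₃) {x y : Fin 3 → ℝ} (h : x ≤ y) {i j l : Fin 3}
    (hij : i ≠ j) (hjl : j ≠ l) (hil : i ≠ l) :
    M.img (cubeVertex h {i, l}) (cubeVertex h Finset.univ) ⊓
        (M.img (cubeVertex h {j, l}) (cubeVertex h Finset.univ) ⊔
          M.img (cubeVertex h {i, j}) (cubeVertex h Finset.univ)) ≤
      M.img (cubeVertex h {l}) (cubeVertex h Finset.univ) ⊔
        M.img (cubeVertex h {i}) (cubeVertex h Finset.univ) := by
  have F3 := finset_fin_three_facts i j l hij hjl hil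
  have h0 : ({i, l} : Finset (Fin 3)) ≠ Finset.univ := F3.1
  have h1 : ({j, l} : Finset (Fin 3)) ≠ Finset.univ :=
    (finset_fin_three_facts j i l hij.symm hil hjl).1
  have h2 : ({i, j} : Finset (Fin 3)) ≠ Finset.univ :=
    (finset_fin_three_facts i l j hil hjl.symm hij).1
  set R := M.img (cubeVertex h {l}) (cubeVertex h Finset.univ) ⊔
        M.img (cubeVertex h {i}) (cubeVertex h Finset.univ)
  have hle : ∀ T, cubeVertex h T ≤ cubeVertex h Finset.univ := fun T =>
    (cubeVertex h).monotone (Finset.subset_univ T)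
  let F := (M.restrict (cubeVertex h)).restrict
    (OrderHom.Subtype.val (fun T : Finset (Fin 3) => T ≠ Finset.univ))
  let W : ModuleCat.{w} k := ModuleCat.of k (M.space (cubeVertex h Finset.univ) ⧸ R)
  -- This is a cocone: every vertex strictly below `{i, l}` maps through `{i}` or `{l}`, hence to
  -- zero modulo `R`, and no proper vertex lies strictly above `{i, l}`.
  let f : ∀ T : {T : Finset (Fin 3) // T ≠ Finset.univ}, M.space (cubeVertex h T.1) →ₗ[k] W :=
    fun T => if T.1 = {i, l} then R.mkQ ∘ₗ M.rho (hle T.1) else 0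
  have hf : ∀ (T T' : {T : Finset (Fin 3) // T ≠ Finset.univ}) (hT : T ≤ T')
      (a : M.space (cubeVertex h T.1)),
      f T' (M.rho ((cubeVertex h).monotone hT) a) = f T a := by
    rintro ⟨T, hT₁⟩ ⟨T', hT₁'⟩ hT a
    by_cases h' : T' = {i, l}
    · by_cases h'' : T = {i, l}
      · simp only [f, if_pos h', if_pos h'', LinearMap.comp_apply]
        rw [M.rho_rho]
      · simp only [f, if_pos h', if_neg h'', LinearMap.comp_apply]
        rw [M.rho_rho, LinearMap.zero_apply, Submodule.mkQ_apply, Submodule.Quotient.mk_eq_zero]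
        have ha : M.rho (hle T) a ∈ M.img (cubeVertex h T) (cubeVertex h Finset.univ) := by
          rw [M.img_of_le (hle T)]
          exact ⟨a, rfl⟩
        rcases F3.2.1 T (h' ▸ hT) h'' with h₁ | h₁
        · exact Submodule.mem_sup_left (M.img_mono _ ((cubeVertex h).monotone h₁) ha)
        · exact Submodule.mem_sup_right (M.img_mono _ ((cubeVertex h).monotone h₁) ha)
    · have h'' : T ≠ {i, l} := fun h'' => h' (F3.2.2.1 T' (h'' ▸ hT) hT₁')
      simp only [f, if_neg h', if_neg h'', LinearMap.zero_apply]
  let c : Cocone F :=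
    { pt := W
      ι :=
        { app := fun T => ModuleCat.ofHom (f T)
          naturality := fun T T' g => by
            ext a
            exact hf T T' (leOfHom g) a } }
  have hι : ∀ (T : {T : Finset (Fin 3) // T ≠ Finset.univ}) (a : M.space (cubeVertex h T.1)),
      (colimit.desc F c).hom ((colimit.ι F T).hom a) = f T a := fun T a =>
    congrArg (fun g => g.hom a) (colimit.ι_desc c T)
  have hφ : ∀ (T : {T : Finset (Fin 3) // T ≠ Finset.univ}) (a : M.space (cubeVertex h T.1)),
      (phi (M.restrict (cubeVertex h))).hom ((colimit.ι F T).hom a) = M.rho (hle T.1) a :=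
    fun T a => by
      have : colimit.ι F T ≫ phi (M.restrict (cubeVertex h)) = ModuleCat.ofHom (M.rho (hle T.1)) :=
        colimit.ι_desc _ _
      exact congrArg (fun g => g.hom a) this
  rw [M.img_of_le (hle _), M.img_of_le (hle {j, l}), M.img_of_le (hle {i, j})]
  rintro _ ⟨⟨a, rfl⟩, ha⟩
  obtain ⟨_, ⟨b, rfl⟩, _, ⟨d, rfl⟩, hbd⟩ := Submodule.mem_sup.1 ha
  have hz : M.rho (hle _) a - M.rho (hle _) b - M.rho (hle _) d = 0 := by
    rw [sub_sub, hbd, sub_self]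
  have h0' : (colimit.ι F ⟨_, h0⟩).hom a - (colimit.ι F ⟨_, h1⟩).hom b -
      (colimit.ι F ⟨_, h2⟩).hom d = 0 := by
    apply hM.phi_injective x y h
    rw [map_sub, map_sub, hφ, hφ, hφ, map_zero]
    exact hz
  have h3 := congrArg (colimit.desc F c).hom h0'
  rw [map_sub, map_sub, hι, hι, hι, map_zero] at h3
  have e1 : ({j, l} : Finset (Fin 3)) ≠ {i, l} := F3.2.2.2
  have e2 : ({i, j} : Finset (Fin 3)) ≠ {i, l} := by
    rw [Finset.pair_comm i j, Finset.pair_comm i l]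
    exact (finset_fin_three_facts l j i hjl.symm hij.symm hil.symm).2.2.2
  rw [show f ⟨_, h1⟩ = 0 from if_neg e1, show f ⟨_, h2⟩ = 0 from if_neg e2,
    show f ⟨_, h0⟩ = R.mkQ ∘ₗ M.rho (hle _) from if_pos rfl, LinearMap.zero_apply,
    LinearMap.zero_apply, sub_zero, sub_zero] at h3
  exact (Submodule.Quotient.mk_eq_zero R).1 h3

/-- The images along the three coordinate directions satisfy the distributive law. -/
theorem img_update_dist (hM : M.StronglyExact₃) (t r : Fin 3 → ℝ) {i j l : Fin 3}
    (hij : i ≠ j) (hjl : j ≠ l) (hil : i ≠ l) :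
    M.img (Function.update t j (r j)) t ⊓
        (M.img (Function.update t i (r i)) t ⊔ M.img (Function.update t l (r l)) t) ≤
      M.img (Function.update t j (r j)) t ⊓ M.img (Function.update t i (r i)) t ⊔
        M.img (Function.update t j (r j)) t ⊓ M.img (Function.update t l (r l)) t := by
  have h : r ⊓ t ≤ t := inf_le_right
  have key := cubeVertex_dist hM h hij hjl hil
  have h1 : cubeVertex h Finset.univ = t := by ext m; simp [cubeVertex]
  have e : ∀ m, Function.update t m (r m) ⊓ t = cubeVertex h (Finset.univ.erase m) := by
    intro m
    ext m'
    by_cases hm' : m' = m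
    · subst hm'; simp [cubeVertex]
    · simp [cubeVertex, hm']
  rw [h1] at key
  have E : ∀ i j l : Fin 3, i ≠ j → j ≠ l → i ≠ l →
    Finset.univ.erase j = {i, l} ∧ Finset.univ.erase i = {j, l} ∧ Finset.univ.erase l = {i, j} ∧
    {l} ⊆ Finset.univ.erase i ∧ {l} ⊆ Finset.univ.erase j ∧ {i} ⊆ Finset.univ.erase j ∧
    {i} ⊆ Finset.univ.erase l := by decide
  obtain ⟨E1, E2, E3, E4, E5, E6, E7⟩ := E i j l hij hjl hil
  rw [← img_inf_self (Function.update t j (r j)), ← img_inf_self (Function.update t i (r i)),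
    ← img_inf_self (Function.update t l (r l)), e, e, e]
  rw [← E1, ← E2, ← E3] at key
  have hmono : ∀ {S T : Finset (Fin 3)}, S ⊆ T → M.img (cubeVertex h S) t ≤ M.img (cubeVertex h T) t :=
    fun hST => M.img_mono t ((cubeVertex h).monotone hST)
  exact key.trans (sup_le_sup (le_inf (hmono E5) (hmono E4)) (le_inf (hmono E6) (hmono E7)))

end Space
end PersistenceModule

/-! ### Cuts, cuboids and lattice lemmas for subspaces. -/

namespace RealCut

variable (c : RealCut) {x y : ℝ}

theorem mem_upper_iff : x ∈ c.upper ↔ x ∉ c.lower := by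
  rw [← c.isCompl.compl_eq]; rfl

theorem mem_lower_iff : x ∈ c.lower ↔ x ∉ c.upper := by
  rw [c.mem_upper_iff, not_not]

variable {c}

theorem mem_upper_of_le (hx : x ∈ c.upper) (h : x ≤ y) : y ∈ c.upper := by
  rw [mem_upper_iff]
  exact fun hy => (c.lt_of_mem y hy x hx).not_ge h

theorem mem_lower_of_le (hy : y ∈ c.lower) (h : x ≤ y) : x ∈ c.lower := by
  rw [mem_lower_iff]
  exact fun hx => (c.lt_of_mem y hy x hx).not_ge h

theorem upper_eq_univ (h : c.lower = ∅) : c.upper = Set.univ := by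
  ext x; simp [mem_upper_iff, h]

theorem lower_eq_univ (h : c.upper = ∅) : c.lower = Set.univ := by
  ext x; simp [mem_lower_iff, h]

/-- The cut with empty lower part. -/
def atBot : RealCut where
  lower := ∅
  upper := Set.univ
  isCompl := isCompl_bot_top
  lt_of_mem := by simp

/-- The cut with empty upper part. -/
def atTop : RealCut where
  lower := Set.univ
  upper := ∅
  isCompl := isCompl_top_bot
  lt_of_mem := by simp

end RealCut

theorem univ_eq_cuboid :
    (Set.univ : Set (Fin 3 → ℝ)) = cuboid (fun _ => RealCut.atBot) (fun _ => RealCut.atTop) := by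
  ext t; simp [cuboid, RealCut.atBot, RealCut.atTop]

theorem inf_mem_cuboid {c d : Fin 3 → RealCut} {s t : Fin 3 → ℝ} (hs : s ∈ cuboid c d)
    (ht : t ∈ cuboid c d) : s ⊓ t ∈ cuboid c d := fun i => by
  rcases min_choice (s i) (t i) with h | h
  · exact (congrArg (· ∈ (c i).upper ∩ (d i).lower) h).mpr (hs i)
  · exact (congrArg (· ∈ (c i).upper ∩ (d i).lower) h).mpr (ht i)

theorem sup_mem_cuboid {c d : Fin 3 → RealCut} {s t : Fin 3 → ℝ} (hs : s ∈ cuboid c d)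
    (ht : t ∈ cuboid c d) : s ⊔ t ∈ cuboid c d := fun i => by
  rcases max_choice (s i) (t i) with h | h
  · exact (congrArg (· ∈ (c i).upper ∩ (d i).lower) h).mpr (hs i)
  · exact (congrArg (· ∈ (c i).upper ∩ (d i).lower) h).mpr (ht i)

theorem update_mem_cuboid {c d : Fin 3 → RealCut} {t : Fin 3 → ℝ} (ht : t ∈ cuboid c d) {i : Fin 3}
    {r : ℝ} (hr : r ∈ (c i).upper ∩ (d i).lower) : Function.update t i r ∈ cuboid c d := fun j => by
  by_cases hj : j = i
  · subst hj; simpa using hr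
  · simpa [hj] using ht j

theorem Submodule.mem_biSup_of_monotone {k V : Type*} [Field k] [AddCommGroup V] [Module k V]
    {f : ℝ → Submodule k V} (hf : Monotone f) (S : Set ℝ) {x : V} :
    x ∈ ⨆ r ∈ S, f r ↔ x = 0 ∨ ∃ r ∈ S, x ∈ f r := by
  constructor
  · intro hx
    rcases S.eq_empty_or_nonempty with rfl | hS
    · left; simpa using hx
    · right
      have := hS.to_subtype
      rw [iSup_subtype', Submodule.mem_iSup_of_directed] at hx
      · obtain ⟨r, hr⟩ := hx
        exact ⟨r, r.2, hr⟩
      · exact Monotone.directed_le fun r r' h => hf h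
  · rintro (rfl | ⟨r, hr, hx⟩)
    · exact zero_mem _
    · exact Submodule.mem_iSup_of_mem r (Submodule.mem_iSup_of_mem hr hx)

theorem Submodule.mem_iSup_fin_three {k V : Type*} [Field k] [AddCommGroup V] [Module k V]
    {p : Fin 3 → Submodule k V} {x : V} :
    x ∈ ⨆ i, p i ↔ ∃ a : Fin 3 → V, (∀ i, a i ∈ p i) ∧ a 0 + a 1 + a 2 = x := by
  constructor
  · intro hx
    have : ⨆ i, p i ≤ p 0 ⊔ p 1 ⊔ p 2 := iSup_le fun i => by
      fin_cases i
      · exact le_sup_left.trans le_sup_left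
      · exact le_sup_right.trans le_sup_left
      · exact le_sup_right
    obtain ⟨y, hy, z, hz, rfl⟩ := Submodule.mem_sup.1 (this hx)
    obtain ⟨v, hv, w, hw, rfl⟩ := Submodule.mem_sup.1 hy
    exact ⟨![v, w, z], by simp [Fin.forall_fin_succ, hv, hw, hz], rfl⟩
  · rintro ⟨a, ha, rfl⟩
    have h := fun i => Submodule.mem_iSup_of_mem i (ha i)
    exact add_mem (add_mem (h 0) (h 1)) (h 2)

/-- Write `x` as a sum of elements of the `A i`. For each `j` in turn, the summand in `A j` is
already in `X j`, and the distributive law moves the other two into `X j`. Each such correction lies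
in both `A`'s involved, so memberships obtained earlier survive. -/
theorem Submodule.iInf_inf_iSup_le {k V : Type*} [Field k] [AddCommGroup V] [Module k V]
    {X A : Fin 3 → Submodule k V} (hA : ∀ i, A i ≤ X i)
    (hd : ∀ i j l, i ≠ j → j ≠ l → i ≠ l → X j ⊓ (A i ⊔ A l) ≤ X j ⊓ A i ⊔ X j ⊓ A l) :
    (⨅ i, X i) ⊓ (⨆ i, A i) ≤ ⨆ i, (⨅ j, X j) ⊓ A i := by
  rintro x ⟨hX, hx⟩
  have hX : ∀ i, x ∈ X i := by simpa using hX
  obtain ⟨a, ha, hax⟩ := Submodule.mem_iSup_fin_three.1 hx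
  have split : ∀ i j l, i ≠ j → j ≠ l → i ≠ l → ∀ y ∈ A i, ∀ z ∈ A l, y + z ∈ X j →
      ∃ y' ∈ A i, y' ∈ X j ∧ ∃ z' ∈ A l, z' ∈ X j ∧ y' + z' = y + z := by
    intro i j l h1 h2 h3 y hy z hz hyz
    obtain ⟨y', hy', z', hz', h⟩ := Submodule.mem_sup.1
      (hd i j l h1 h2 h3 ⟨hyz, Submodule.add_mem_sup hy hz⟩)
    exact ⟨y', hy'.2, hy'.1, z', hz'.2, hz'.1, h⟩
  obtain ⟨b1, hb1, hb1', b2, hb2, hb2', hb⟩ := split 1 0 2 (by decide) (by decide) (by decide)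
    (a 1) (ha 1) (a 2) (ha 2) (by
      have := sub_mem (hX 0) (hA 0 (ha 0))
      rwa [← hax, add_assoc, add_sub_cancel_left] at this)
  obtain ⟨c0, hc0, hc0', c2, hc2, hc2', hc⟩ := split 0 1 2 (by decide) (by decide) (by decide)
    (a 0) (ha 0) b2 hb2 (by
      have := sub_mem (hX 1) (hA 1 hb1)
      rwa [← hax, add_assoc, ← hb, add_comm b1, ← add_assoc, add_sub_cancel_right] at this)
  have hc2'' : c2 ∈ X 0 := by
    have : c2 = b2 - (c0 - a 0) := by rw [eq_sub_iff_add_eq, ← sub_eq_iff_eq_add'.2 hc]; abel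
    rw [this]
    exact sub_mem hb2' (hA 0 (sub_mem hc0 (ha 0)))
  have hx' : x = c0 + b1 + c2 := by
    rw [← hax, add_assoc, ← hb, add_right_comm, hc]; abel
  obtain ⟨d0, hd0, hd0', d1, hd1, hd1', hdd⟩ := split 0 2 1 (by decide) (by decide) (by decide)
    c0 hc0 b1 hb1 (by
      have := sub_mem (hX 2) (hA 2 hc2)
      rwa [hx', add_sub_cancel_right] at this)
  have hd0'' : d0 ∈ X 1 := by
    have : d0 = c0 + (b1 - d1) := by rw [← add_sub_assoc, ← hdd]; abel
    rw [this]
    exact add_mem hc0' (hA 1 (sub_mem hb1 hd1))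
  have hd1'' : d1 ∈ X 0 := by
    have : d1 = b1 - (d0 - c0) := by rw [eq_sub_iff_add_eq, ← sub_eq_iff_eq_add'.2 hdd]; abel
    rw [this]
    exact sub_mem hb1' (hA 0 (sub_mem hd0 hc0))
  rw [hx', ← hdd]
  refine add_mem (add_mem ?_ ?_) ?_
  · refine Submodule.mem_iSup_of_mem 0 ⟨?_, hd0⟩
    simpa [Submodule.mem_iInf, Fin.forall_fin_succ] using ⟨hA 0 hd0, hd0'', hd0'⟩
  · refine Submodule.mem_iSup_of_mem 1 ⟨?_, hd1⟩
    simpa [Submodule.mem_iInf, Fin.forall_fin_succ] using ⟨hd1'', hA 1 hd1, hd1'⟩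
  · refine Submodule.mem_iSup_of_mem 2 ⟨?_, hc2⟩
    simpa [Submodule.mem_iInf, Fin.forall_fin_succ] using ⟨hc2'', hc2', hA 2 hc2⟩

/-! ### Directional images and kernels, and the subspaces attached to a cuboid. -/

namespace PersistenceModule

section Cuts

variable {k : Type u} [Field k] (M : PersistenceModule.{u, w} k (Fin 3 → ℝ))

/-- The intersection of the images from the points with `i`-th coordinate above the cut. -/
def iPlus (i : Fin 3) (c : RealCut) (t : Fin 3 → ℝ) : Submodule k (M.space t) :=
  ⨅ r ∈ c.upper, M.img (Function.update t i r) t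

/-- The union of the images from the points with `i`-th coordinate below the cut. -/
def iMinus (i : Fin 3) (c : RealCut) (t : Fin 3 → ℝ) : Submodule k (M.space t) :=
  ⨆ r ∈ c.lower, M.img (Function.update t i r) t

/-- The intersection of the kernels to the points with `i`-th coordinate above the cut. -/
def kPlus (i : Fin 3) (d : RealCut) (t : Fin 3 → ℝ) : Submodule k (M.space t) :=
  ⨅ r ∈ d.upper, M.kr (Function.update t i r) t

/-- The union of the kernels to the points with `i`-th coordinate below the cut. -/
def kMinus (i : Fin 3) (d : RealCut) (t : Fin 3 → ℝ) : Submodule k (M.space t) :=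
  ⨆ r ∈ d.lower, M.kr (Function.update t i r) t

variable {M} {i j : Fin 3} {c d : RealCut} {t : Fin 3 → ℝ} {x : M.space t}

theorem update_monotone (t : Fin 3 → ℝ) (i : Fin 3) : Monotone (Function.update t i) :=
  fun r r' h j => by
    by_cases hj : j = i
    · subst hj; simpa using h
    · simp [hj]

theorem monotone_img_update (i : Fin 3) (t : Fin 3 → ℝ) :
    Monotone fun r => M.img (Function.update t i r) t :=
  fun _ _ h => M.img_mono t (update_monotone t i h)

theorem monotone_kr_update (i : Fin 3) (t : Fin 3 → ℝ) :
    Monotone fun r => M.kr (Function.update t i r) t :=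
  fun _ _ h => M.kr_mono t (update_monotone t i h)

theorem mem_iPlus : x ∈ M.iPlus i c t ↔ ∀ r ∈ c.upper, x ∈ M.img (Function.update t i r) t := by
  simp [iPlus]

theorem mem_kPlus : x ∈ M.kPlus i c t ↔ ∀ r ∈ c.upper, x ∈ M.kr (Function.update t i r) t := by
  simp [kPlus]

theorem mem_iMinus :
    x ∈ M.iMinus i c t ↔ x = 0 ∨ ∃ r ∈ c.lower, x ∈ M.img (Function.update t i r) t :=
  Submodule.mem_biSup_of_monotone (monotone_img_update i t) _

theorem mem_kMinus :
    x ∈ M.kMinus i c t ↔ x = 0 ∨ ∃ r ∈ c.lower, x ∈ M.kr (Function.update t i r) t :=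
  Submodule.mem_biSup_of_monotone (monotone_kr_update i t) _

theorem iMinus_le_img {r : ℝ} (hr : r ∈ c.upper) :
    M.iMinus i c t ≤ M.img (Function.update t i r) t :=
  iSup₂_le fun r' hr' => monotone_img_update i t (c.lt_of_mem r' hr' r hr).le

theorem iMinus_le_iPlus : M.iMinus i c t ≤ M.iPlus i c t :=
  le_iInf₂ fun _ hr => iMinus_le_img hr

theorem kMinus_le_kr {r : ℝ} (hr : r ∈ c.upper) :
    M.kMinus i c t ≤ M.kr (Function.update t i r) t :=
  iSup₂_le fun r' hr' => monotone_kr_update i t (c.lt_of_mem r' hr' r hr).le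

theorem kMinus_le_kPlus : M.kMinus i d t ≤ M.kPlus i d t :=
  le_iInf₂ fun _ hr => kMinus_le_kr hr

theorem kMinus_le_iPlus (hM : M.StronglyExact₃) (hij : i ≠ j) : M.kMinus i d t ≤ M.iPlus j c t :=
  iSup₂_le fun _ _ => le_iInf₂ fun _ _ => kr_update_le_img_update hM hij t _ _

theorem kMinus_le_iMinus (hM : M.StronglyExact₃) (hij : i ≠ j) (hc : c.lower.Nonempty) :
    M.kMinus i d t ≤ M.iMinus j c t :=
  iSup₂_le fun _ _ => (kr_update_le_img_update hM hij t _ _).trans (le_iSup₂_of_le _ hc.some_mem le_rfl)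

theorem kPlus_le_iPlus (hM : M.StronglyExact₃) (hij : i ≠ j) (hd : d.upper.Nonempty) :
    M.kPlus i d t ≤ M.iPlus j c t :=
  le_iInf₂ fun _ _ => (iInf₂_le _ hd.some_mem).trans (kr_update_le_img_update hM hij t _ _)

theorem iMinus_eq_bot (hc : c.lower = ∅) : M.iMinus i c t = ⊥ := by
  simp [iMinus, hc]

variable {c d : Fin 3 → RealCut}

/-- By `mem_img_iff` the points of the cuboid that differ from `t` in one coordinate suffice. A
level `r` above `t i` imposes no condition. The three companion lemmas rest on the same reduction: a
point below `t` and outside the cuboid violates a lower cut, a point above and outside violates an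
upper cut. -/
theorem imInter_cuboid (hM : M.StronglyExact₃) (ht : t ∈ cuboid c d) :
    M.imInter (cuboid c d) t = ⨅ i, M.iPlus i (c i) t := by
  refine le_antisymm (le_iInf fun i => le_iInf₂ fun r hr => ?_)
    (le_iInf fun s => le_iInf₂ fun hs hst => ?_)
  · rcases le_total r (t i) with h | h
    · have hle : Function.update t i r ≤ t := by
        conv_rhs => rw [← Function.update_eq_self i t]
        exact update_monotone t i h
      rw [M.img_of_le hle]
      exact iInf_le_of_le _ (iInf₂_le_of_le (update_mem_cuboid ht
        ⟨hr, RealCut.mem_lower_of_le (ht i).2 h⟩) hle le_rfl)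
    · rw [M.img_eq_top]
      · exact le_top
      · conv_lhs => rw [← Function.update_eq_self i t]
        exact update_monotone t i h
  · intro x hx
    rw [← M.img_of_le hst, mem_img_iff hM]
    exact fun i => mem_iPlus.1 ((Submodule.mem_iInf _).1 hx i) _ (hs i).1

theorem imSum_cuboid (hM : M.StronglyExact₃) (ht : t ∈ cuboid c d) :
    M.imSum (cuboid c d) t = ⨆ i, M.iMinus i (c i) t := by
  refine le_antisymm (iSup_le fun s => iSup₂_le fun hs hst => ?_)
    (iSup_le fun i => iSup₂_le fun r hr => ?_)
  · obtain ⟨i, hi⟩ : ∃ i, s i ∈ (c i).lower := by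
      by_contra! h
      exact hs fun i => ⟨(c i).mem_upper_iff.2 (h i), RealCut.mem_lower_of_le (ht i).2 (hst i)⟩
    rw [← M.img_of_le hst]
    intro x hx
    exact Submodule.mem_iSup_of_mem i (mem_iMinus.2 (.inr ⟨_, hi, (mem_img_iff hM).1 hx i⟩))
  · have h := (c i).lt_of_mem r hr _ (ht i).1
    have hle : Function.update t i r ≤ t := by
      conv_rhs => rw [← Function.update_eq_self i t]
      exact update_monotone t i h.le
    rw [M.img_of_le hle]
    refine le_iSup_of_le _ (le_iSup₂_of_le (fun hB => ?_) hle le_rfl)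
    have := (hB i).1
    rw [Function.update_self] at this
    exact (c i).mem_upper_iff.1 this hr

theorem kerInter_cuboid (hM : M.StronglyExact₃) (ht : t ∈ cuboid c d) :
    M.kerInter (cuboid c d) t = ⨅ i, M.kPlus i (d i) t := by
  refine le_antisymm (le_iInf fun i => le_iInf₂ fun r hr => ?_)
    (le_iInf fun u => le_iInf₂ fun hu htu => ?_)
  · have h := (d i).lt_of_mem _ (ht i).2 r hr
    have hle : t ≤ Function.update t i r := by
      conv_lhs => rw [← Function.update_eq_self i t]
      exact update_monotone t i h.le
    rw [M.kr_of_le hle]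
    refine iInf_le_of_le _ (iInf₂_le_of_le (fun hB => ?_) hle le_rfl)
    have := (hB i).2
    rw [Function.update_self] at this
    exact (d i).mem_lower_iff.1 this hr
  · obtain ⟨i, hi⟩ : ∃ i, u i ∈ (d i).upper := by
      by_contra! h
      exact hu fun i => ⟨RealCut.mem_upper_of_le (ht i).1 (htu i), (d i).mem_lower_iff.2 (h i)⟩
    rw [← M.kr_of_le htu, kr_eq_iSup hM]
    intro x hx
    exact Submodule.mem_iSup_of_mem i (mem_kPlus.1 ((Submodule.mem_iInf _).1 hx i) _ hi)

theorem kerSum_cuboid (hM : M.StronglyExact₃) (ht : t ∈ cuboid c d) :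
    M.kerSum (cuboid c d) t = ⨆ i, M.kMinus i (d i) t := by
  refine le_antisymm (iSup_le fun u => iSup₂_le fun hu htu => ?_)
    (iSup_le fun i => iSup₂_le fun r hr => ?_)
  · rw [← M.kr_of_le htu, kr_eq_iSup hM]
    exact iSup_mono fun i => le_iSup₂_of_le _ (hu i).2 le_rfl
  · rcases le_total (t i) r with h | h
    · have hle : t ≤ Function.update t i r := by
        conv_lhs => rw [← Function.update_eq_self i t]
        exact update_monotone t i h
      rw [M.kr_of_le hle]
      exact le_iSup_of_le _ (le_iSup₂_of_le (update_mem_cuboid ht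
        ⟨RealCut.mem_upper_of_le (ht i).1 h, hr⟩) hle le_rfl)
    · rw [M.kr_eq_bot]
      · exact bot_le
      · conv_rhs => rw [← Function.update_eq_self i t]
        exact update_monotone t i h

/-- Distributivity of images over the sum of the parts below the cuts. -/
theorem img_inf_iSup_iMinus_le (hM : M.StronglyExact₃) {q : Fin 3 → ℝ}
    (hq : ∀ i, q i ∈ (c i).upper) :
    M.img q t ⊓ (⨆ i, M.iMinus i (c i) t) ≤ ⨆ i, M.img q t ⊓ M.iMinus i (c i) t := by
  have hX : M.img q t = ⨅ i, M.img (Function.update t i (q i)) t := by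
    ext x; rw [mem_img_iff hM, Submodule.mem_iInf]
  rw [hX]
  refine Submodule.iInf_inf_iSup_le (fun i => iMinus_le_img (hq i)) ?_
  intro i j l hij hjl hil x ⟨hx, hx'⟩
  obtain ⟨y, hy, z, hz, rfl⟩ := Submodule.mem_sup.1 hx'
  rcases mem_iMinus.1 hy with rfl | ⟨r, hr, hy'⟩
  · rw [zero_add] at hx ⊢
    exact Submodule.mem_sup_right ⟨hx, hz⟩
  rcases mem_iMinus.1 hz with rfl | ⟨r', hr', hz'⟩
  · rw [add_zero] at hx ⊢
    exact Submodule.mem_sup_left ⟨hx, hy⟩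
  -- One auxiliary point carries all three levels: `r` in direction `i`, `r'` in direction `l`, and
  -- `q j` in direction `j`.
  have := img_update_dist hM t (Function.update (Function.update q i r) l r') hij hjl hil
  simp only [Function.update_self, Function.update_of_ne hil, Function.update_of_ne hjl,
    Function.update_of_ne hij.symm] at this
  refine (this.trans (sup_le_sup (inf_le_inf_left _ ?_) (inf_le_inf_left _ ?_)))
    ⟨hx, Submodule.add_mem_sup hy' hz'⟩
  · exact le_iSup₂_of_le r hr le_rfl
  · exact le_iSup₂_of_le r' hr' le_rfl

/-- The argument depends on how many lower cuts are proper. With at least two, every directional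
kernel lies in an image from below in another direction, so `K⁻ ≤ I⁻`. With exactly one, in
direction `j`, only the terms of direction `j` remain; the kernel term lies in `I⁺` in the other
directions, so the image term is in `I⁺` and both terms are in `V⁻`. With none, `I⁻ = 0`. -/
theorem vPlus_inf_le_vMinus (hM : M.StronglyExact₃) (ht : t ∈ cuboid c d) :
    M.vPlus (cuboid c d) t ⊓ (M.imSum (cuboid c d) t ⊔ M.kerSum (cuboid c d) t) ≤
      M.vMinus (cuboid c d) t := by
  rintro x ⟨⟨hxi, hxk⟩, hx⟩
  by_cases h2 : ∃ j l, j ≠ l ∧ (c j).lower.Nonempty ∧ (c l).lower.Nonempty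
  · obtain ⟨j, l, hjl, hj, hl⟩ := h2
    have : M.kerSum (cuboid c d) t ≤ M.imSum (cuboid c d) t := by
      rw [kerSum_cuboid hM ht, imSum_cuboid hM ht]
      refine iSup_le fun i => ?_
      by_cases hij : i = j
      · exact (kMinus_le_iMinus hM (hij ▸ hjl) hl).trans (le_iSup (fun i => M.iMinus i (c i) t) l)
      · exact (kMinus_le_iMinus hM hij hj).trans (le_iSup (fun i => M.iMinus i (c i) t) j)
    rw [sup_eq_left.2 this] at hx
    exact Submodule.mem_sup_right ⟨⟨hx, hxi⟩, hxk⟩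
  by_cases h1 : ∃ j, (c j).lower.Nonempty
  · obtain ⟨j, hj⟩ := h1
    have h0 : ∀ i, i ≠ j → (c i).lower = ∅ := fun i hi => by
      by_contra h
      exact h2 ⟨i, j, hi, Set.nonempty_iff_ne_empty.2 h, hj⟩
    have hle : M.imSum (cuboid c d) t ⊔ M.kerSum (cuboid c d) t ≤
        M.iMinus j (c j) t ⊔ M.kMinus j (d j) t := by
      rw [imSum_cuboid hM ht, kerSum_cuboid hM ht]
      refine sup_le (iSup_le fun i => ?_) (iSup_le fun i => ?_) <;> by_cases hij : i = j
      · subst hij; exact le_sup_left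
      · rw [iMinus_eq_bot (h0 i hij)]; exact bot_le
      · subst hij; exact le_sup_right
      · exact (kMinus_le_iMinus hM hij hj).trans le_sup_left
    obtain ⟨a, ha, n, hn, rfl⟩ := Submodule.mem_sup.1 (hle hx)
    have hnk : n ∈ M.kerSum (cuboid c d) t := by
      rw [kerSum_cuboid hM ht]
      exact Submodule.mem_iSup_of_mem j hn
    have hai : a ∈ M.imInter (cuboid c d) t := by
      have hxi := (Submodule.mem_iInf _).1 ((imInter_cuboid hM ht).le hxi)
      rw [imInter_cuboid hM ht, Submodule.mem_iInf]
      intro i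
      by_cases hij : i = j
      · subst hij; exact iMinus_le_iPlus ha
      · have := sub_mem (hxi i) (kMinus_le_iPlus hM (Ne.symm hij) hn)
        rwa [add_sub_cancel_right] at this
    rw [add_comm]
    refine Submodule.add_mem_sup ⟨?_, hnk⟩ ⟨⟨?_, hai⟩, ?_⟩
    · have := sub_mem hxi hai
      rwa [add_sub_cancel_left] at this
    · rw [imSum_cuboid hM ht]
      exact Submodule.mem_iSup_of_mem j ha
    · have := sub_mem hxk (Submodule.mem_sup_right hnk)
      rwa [add_sub_cancel_right] at this
  · have : M.imSum (cuboid c d) t = ⊥ := by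
      rw [imSum_cuboid hM ht, iSup_eq_bot]
      exact fun i => iMinus_eq_bot (Set.not_nonempty_iff_eq_empty.1 fun h => h1 ⟨i, h⟩)
    rw [this, bot_sup_eq] at hx
    exact Submodule.mem_sup_left ⟨hxi, hx⟩

end Cuts

end PersistenceModule

/-- In an inverse system of finite-dimensional vector spaces with surjective transition maps, the
projections from the limit are surjective. -/
theorem exists_compatible_family_of_surjective {k : Type*} [Field k] {ι : Type*} [Preorder ι]
    [IsCodirectedOrder ι] (V : ι → Type*) [∀ i, AddCommGroup (V i)] [∀ i, Module k (V i)]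
    [∀ i, FiniteDimensional k (V i)] (f : ∀ i j, i ≤ j → V i →ₗ[k] V j)
    (hid : ∀ i x, f i i le_rfl x = x)
    (hcomp : ∀ i j l (hij : i ≤ j) (hjl : j ≤ l) x, f j l hjl (f i j hij x) = f i l (hij.trans hjl) x)
    (hsurj : ∀ i j hij, Function.Surjective (f i j hij)) (t : ι) (x : V t) :
    ∃ y : ∀ i, V i, (∀ i j hij, f i j hij (y i) = y j) ∧ y t = x := by
  classical
  -- Dualizing turns the inverse system into a direct system with injective maps, where extending a
  -- functional replaces choosing a compatible family.
  let G : ιᵒᵈ → Type _ := fun i => Module.Dual k (V (OrderDual.ofDual i))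
  let g : ∀ i j : ιᵒᵈ, i ≤ j → G i →ₗ[k] G j := fun i j hij =>
    (f (OrderDual.ofDual j) (OrderDual.ofDual i) hij).dualMap
  have hg : DirectedSystem G fun i j h => g i j h :=
    { map_self := fun i ξ => LinearMap.ext fun v => congrArg ξ (hid _ v)
      map_map := fun i j l hij hjl ξ => LinearMap.ext fun v => congrArg ξ (hcomp _ _ _ _ _ v) }
  have : Nonempty ιᵒᵈ := ⟨OrderDual.toDual t⟩
  let D := Module.DirectLimit G g
  let _ : AddCommGroup D := Module.addCommMonoidToAddCommGroup k
  let of : ∀ i, G i →ₗ[k] D := Module.DirectLimit.of k ιᵒᵈ G g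
  have hof : ∀ i j hij ξ, of j (g i j hij ξ) = of i ξ := fun i j hij ξ =>
    Module.DirectLimit.of_f
  have hinj : LinearMap.ker (of (OrderDual.toDual t)) = ⊥ := by
    rw [LinearMap.ker_eq_bot']
    intro ξ hξ
    obtain ⟨j, hj, h0⟩ := Module.DirectLimit.of.zero_exact hξ
    refine LinearMap.ext fun v => ?_
    obtain ⟨v', rfl⟩ := hsurj (OrderDual.ofDual j) t hj v
    exact congrArg (fun η => η v') h0
  -- Evaluation at `x` extends from the dual of `V t` to the direct limit. Restricted to each dual
  -- it is evaluation at a vector, by reflexivity, and these vectors form the family.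
  obtain ⟨p, hp⟩ := LinearMap.exists_leftInverse_of_injective _ hinj
  let φ : D →ₗ[k] k := (Module.Dual.eval k (V t) x) ∘ₗ p
  let y : ∀ i, V i := fun i => (Module.evalEquiv k (V i)).symm (φ ∘ₗ of (OrderDual.toDual i))
  have hy : ∀ i (ξ : Module.Dual k (V i)), ξ (y i) = φ (of (OrderDual.toDual i) ξ) := fun i ξ => by
    simp only [y, Module.apply_evalEquiv_symm_apply]
    rfl
  refine ⟨y, fun i j hij => ?_, ?_⟩
  · refine Module.eval_apply_injective k (LinearMap.ext fun ξ => ?_)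
    exact (hy i (ξ ∘ₗ f i j hij)).trans
      ((congrArg φ (hof (OrderDual.toDual j) (OrderDual.toDual i) hij ξ)).trans (hy j ξ).symm)
  · refine Module.eval_apply_injective k (LinearMap.ext fun ξ => ?_)
    exact (hy t ξ).trans (congrArg (fun η : Module.Dual k (V t) => η x) (LinearMap.congr_fun hp ξ))

/-! ### Behaviour of the subspaces under structure maps. -/

namespace PersistenceModule

section Maps

variable {k : Type u} [Field k] {M : PersistenceModule.{u, w} k (Fin 3 → ℝ)}
  {c d : Fin 3 → RealCut} {s t : Fin 3 → ℝ}

theorem mem_imInter {B : Set (Fin 3 → ℝ)} {x : M.space t} :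
    x ∈ M.imInter B t ↔ ∀ s ∈ B, ∀ h : s ≤ t, x ∈ LinearMap.range (M.rho h) := by
  simp only [imInter, Submodule.mem_iInf]

theorem mem_kerInter {B : Set (Fin 3 → ℝ)} {x : M.space t} :
    x ∈ M.kerInter B t ↔ ∀ u ∉ B, ∀ h : t ≤ u, M.rho h x = 0 := by
  simp only [kerInter, Submodule.mem_iInf, LinearMap.mem_ker]

theorem range_le_imSum {B : Set (Fin 3 → ℝ)} (hs : s ∉ B) (h : s ≤ t) :
    LinearMap.range (M.rho h) ≤ M.imSum B t :=
  le_iSup_of_le s (le_iSup₂_of_le hs h le_rfl)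

theorem ker_le_kerSum {B : Set (Fin 3 → ℝ)} (ht : t ∈ B) (h : s ≤ t) :
    LinearMap.ker (M.rho h) ≤ M.kerSum B s :=
  le_iSup_of_le t (le_iSup₂_of_le ht h le_rfl)

theorem mem_kerSum_cuboid (ht : t ∈ cuboid c d) {x : M.space t} :
    x ∈ M.kerSum (cuboid c d) t ↔ ∃ u ∈ cuboid c d, ∃ h : t ≤ u, M.rho h x = 0 := by
  refine ⟨fun hx => ?_, fun ⟨u, hu, h, hx⟩ => ker_le_kerSum hu h hx⟩
  let S : Submodule k (M.space t) :=
    { carrier := {x | ∃ u ∈ cuboid c d, ∃ h : t ≤ u, M.rho h x = 0}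
      zero_mem' := ⟨t, ht, le_rfl, map_zero _⟩
      add_mem' := by
        rintro x y ⟨u, hu, h, hx⟩ ⟨u', hu', h', hy⟩
        refine ⟨u ⊔ u', sup_mem_cuboid hu hu', h.trans le_sup_left, ?_⟩
        rw [map_add, ← M.rho_rho h le_sup_left, hx, map_zero, zero_add,
          ← M.rho_rho h' le_sup_right, hy, map_zero]
      smul_mem' := by
        rintro a x ⟨u, hu, h, hx⟩
        exact ⟨u, hu, h, by rw [map_smul, hx, smul_zero]⟩ }
  have : M.kerSum (cuboid c d) t ≤ S := iSup_le fun u => iSup₂_le fun hu h x hx => ⟨u, hu, h, hx⟩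
  exact this hx

theorem map_imInter_le (hs : s ∈ cuboid c d) (h : s ≤ t) :
    (M.imInter (cuboid c d) s).map (M.rho h) ≤ M.imInter (cuboid c d) t := by
  rintro _ ⟨x, hx, rfl⟩
  refine mem_imInter.2 fun p hp hpt => ?_
  obtain ⟨y, rfl⟩ := mem_imInter.1 hx (s ⊓ p) (inf_mem_cuboid hs hp) inf_le_left
  exact ⟨M.rho inf_le_right y, by rw [M.rho_rho, M.rho_rho]⟩

theorem map_imSum_le (B : Set (Fin 3 → ℝ)) (h : s ≤ t) :
    (M.imSum B s).map (M.rho h) ≤ M.imSum B t := by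
  rw [Submodule.map_le_iff_le_comap]
  refine iSup_le fun p => iSup₂_le fun hp hps => ?_
  rintro _ ⟨y, rfl⟩
  exact range_le_imSum hp (hps.trans h) ⟨y, (M.rho_rho _ _ y).symm⟩

theorem map_kerInter_le (B : Set (Fin 3 → ℝ)) (h : s ≤ t) :
    (M.kerInter B s).map (M.rho h) ≤ M.kerInter B t := by
  rintro _ ⟨x, hx, rfl⟩
  exact mem_kerInter.2 fun u hu htu => by rw [M.rho_rho]; exact mem_kerInter.1 hx u hu _

theorem map_kerSum_le (ht : t ∈ cuboid c d) (h : s ≤ t) :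
    (M.kerSum (cuboid c d) s).map (M.rho h) ≤ M.kerSum (cuboid c d) t := by
  rw [Submodule.map_le_iff_le_comap]
  refine iSup_le fun u => iSup₂_le fun hu hsu => ?_
  intro x hx
  refine ker_le_kerSum (sup_mem_cuboid hu ht) le_sup_right ?_
  rw [LinearMap.mem_ker, M.rho_rho, ← M.rho_rho hsu le_sup_left, LinearMap.mem_ker.1 hx, map_zero]

theorem map_imMinus_le (hs : s ∈ cuboid c d) (h : s ≤ t) :
    (M.imMinus (cuboid c d) s).map (M.rho h) ≤ M.imMinus (cuboid c d) t :=
  (Submodule.map_inf_le _).trans (inf_le_inf (map_imSum_le _ h) (map_imInter_le hs h))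

theorem map_kerPlus_le (ht : t ∈ cuboid c d) (h : s ≤ t) :
    (M.kerPlus (cuboid c d) s).map (M.rho h) ≤ M.kerPlus (cuboid c d) t := by
  rw [kerPlus, Submodule.map_sup]
  exact sup_le_sup (map_kerInter_le _ h) (map_kerSum_le ht h)

theorem map_vMinus_le (hs : s ∈ cuboid c d) (ht : t ∈ cuboid c d) (h : s ≤ t) :
    (M.vMinus (cuboid c d) s).map (M.rho h) ≤ M.vMinus (cuboid c d) t := by
  rw [vMinus, Submodule.map_sup]
  exact sup_le_sup
    ((Submodule.map_inf_le _).trans (inf_le_inf (map_imInter_le hs h) (map_kerSum_le ht h)))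
    ((Submodule.map_inf_le _).trans (inf_le_inf (map_imMinus_le hs h) (map_kerPlus_le ht h)))

theorem vMinus_le_vPlus (B : Set (Fin 3 → ℝ)) (t : Fin 3 → ℝ) : M.vMinus B t ≤ M.vPlus B t :=
  sup_le (inf_le_inf_left _ le_sup_right) (inf_le_inf_right _ inf_le_right)

/-- Distributivity splits `x` into pieces, each in the image from `s` and in an image from below one
cut. By `mem_img_iff` such a piece comes from `s` with that coordinate lowered, a point outside the
cuboid. -/
theorem exists_imSum_lift (hM : M.StronglyExact₃) (hs : s ∈ cuboid c d) (ht : t ∈ cuboid c d)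
    (h : s ≤ t) {x : M.space t} (hx : x ∈ M.imMinus (cuboid c d) t) :
    ∃ y ∈ M.imSum (cuboid c d) s, M.rho h y = x := by
  have h1 : x ∈ M.img s t := by
    rw [M.img_of_le h]
    exact mem_imInter.1 hx.2 s hs h
  have h2 := img_inf_iSup_iMinus_le hM (fun i => (hs i).1) ⟨h1, (imSum_cuboid hM ht).le hx.1⟩
  refine (iSup_le fun i => ?_ : _ ≤ (M.imSum (cuboid c d) s).map (M.rho h)) h2
  rintro a ⟨has, ha⟩
  rcases mem_iMinus.1 ha with rfl | ⟨r, hr, ha⟩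
  · exact zero_mem _
  have hlt := (c i).lt_of_mem r hr _ (hs i).1
  have hle : Function.update s i r ≤ s := by
    conv_rhs => rw [← Function.update_eq_self i s]
    exact update_monotone s i hlt.le
  have hnB : Function.update s i r ∉ cuboid c d := fun hB => by
    have := (hB i).1
    rw [Function.update_self] at this
    exact (c i).mem_upper_iff.1 this hr
  have ha' : a ∈ M.img (Function.update s i r) t := by
    rw [SetLike.mem_coe, mem_img_iff hM] at has
    rw [mem_img_iff hM]
    intro j
    by_cases hj : j = i
    · subst hj; simpa using ha
    · simpa [hj] using has j
  rw [M.img_of_le (hle.trans h)] at ha'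
  obtain ⟨z, rfl⟩ := ha'
  exact ⟨M.rho hle z, range_le_imSum hnB hle ⟨z, rfl⟩, M.rho_rho _ _ z⟩

/-- Push on to a point `u` of the cuboid where the kernel part of the image has died. What is left
lifts to `I⁻` at `s`, and the difference from `x` dies at `u`, so `x ∈ I⁻ + K⁻`. -/
theorem mem_vMinus_of_rho_mem (hM : M.StronglyExact₃) (hs : s ∈ cuboid c d) (ht : t ∈ cuboid c d)
    (h : s ≤ t) {x : M.space s} (hx : x ∈ M.vPlus (cuboid c d) s)
    (hx' : M.rho h x ∈ M.vMinus (cuboid c d) t) : x ∈ M.vMinus (cuboid c d) s := by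
  obtain ⟨a, ha, b, hb, hab⟩ := Submodule.mem_sup.1 hx'
  obtain ⟨u, hu, htu, hau⟩ := (mem_kerSum_cuboid ht).1 ha.2
  have hbu : M.rho htu b ∈ M.imMinus (cuboid c d) u := map_imMinus_le ht htu ⟨b, hb.1, rfl⟩
  obtain ⟨y, hy, hyb⟩ := exists_imSum_lift hM hs hu (h.trans htu) hbu
  refine vPlus_inf_le_vMinus hM hs ⟨hx, Submodule.mem_sup.2 ⟨y, hy, x - y, ?_, by abel⟩⟩
  refine ker_le_kerSum hu (h.trans htu) ?_
  rw [LinearMap.mem_ker, map_sub, hyb, ← M.rho_rho h htu, ← hab, map_add, hau, zero_add, sub_self]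

/-- The cuboid is closed under meets, so the images are codirected, and in finite dimension a
minimal one is the smallest. Lifting along this one image gives `exists_imInter_lift`. -/
theorem exists_imInter_eq_range (hfin : M.IsPfd) (hs : s ∈ cuboid c d) :
    ∃ q ∈ cuboid c d, ∃ h : q ≤ s, M.imInter (cuboid c d) s = LinearMap.range (M.rho h) := by
  have := hfin s
  obtain ⟨R, ⟨q, hq, h, rfl⟩, hmin⟩ := WellFounded.has_min (wellFounded_lt (α := Submodule k (M.space s)))
    {R | ∃ q ∈ cuboid c d, ∃ h : q ≤ s, R = LinearMap.range (M.rho h)}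
    ⟨_, s, hs, le_rfl, rfl⟩
  refine ⟨q, hq, h, le_antisymm (fun x hx => mem_imInter.1 hx q hq h) fun x hx =>
    mem_imInter.2 fun p hp hps => ?_⟩
  have h1 : LinearMap.range (M.rho (inf_le_left.trans h : q ⊓ p ≤ s)) ≤ LinearMap.range (M.rho h) :=
    M.range_rho_mono inf_le_left h
  have h2 := eq_of_le_of_not_lt h1 (hmin _ ⟨q ⊓ p, inf_mem_cuboid hq hp, _, rfl⟩)
  exact M.range_rho_mono inf_le_right hps (h2 ▸ hx)

theorem exists_imInter_lift (hfin : M.IsPfd) (hs : s ∈ cuboid c d) (h : s ≤ t) {x : M.space t}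
    (hx : x ∈ M.imInter (cuboid c d) t) : ∃ y ∈ M.imInter (cuboid c d) s, M.rho h y = x := by
  obtain ⟨q, hq, hqs, hR⟩ := exists_imInter_eq_range hfin hs
  obtain ⟨z, rfl⟩ := mem_imInter.1 hx q hq (hqs.trans h)
  exact ⟨M.rho hqs z, hR ▸ ⟨z, rfl⟩, M.rho_rho _ _ z⟩

theorem exists_kPlus_eq_kr (hfin : M.IsPfd) (i : Fin 3) {d : RealCut} (hd : d.upper.Nonempty)
    (s : Fin 3 → ℝ) : ∃ r ∈ d.upper, M.kPlus i d s = M.kr (Function.update s i r) s := by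
  have := hfin s
  obtain ⟨R, ⟨r, hr, rfl⟩, hmin⟩ := WellFounded.has_min (wellFounded_lt (α := Submodule k (M.space s)))
    {R | ∃ r ∈ d.upper, R = M.kr (Function.update s i r) s} ⟨_, hd.some, hd.some_mem, rfl⟩
  refine ⟨r, hr, le_antisymm (iInf₂_le r hr) (le_iInf₂ fun r' hr' => ?_)⟩
  rcases le_total r r' with h | h
  · exact monotone_kr_update i s h
  · exact (eq_of_le_of_not_lt (monotone_kr_update i s h) (hmin _ ⟨r', hr', rfl⟩)).ge

theorem kerInter_eq_top_or_kPlus (hM : M.StronglyExact₃) {i : Fin 3}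
    (hd : ∀ j, j ≠ i → (d j).upper = ∅) :
    (∀ t ∈ cuboid c d, M.kerInter (cuboid c d) t = ⊤) ∨
      (d i).upper.Nonempty ∧ ∀ t ∈ cuboid c d, M.kerInter (cuboid c d) t = M.kPlus i (d i) t := by
  have h0 : ∀ j, (d j).upper = ∅ → ∀ t, M.kPlus j (d j) t = ⊤ := fun j hj t => by simp [kPlus, hj]
  rcases (d i).upper.eq_empty_or_nonempty with h | h
  · left
    intro t ht
    rw [kerInter_cuboid hM ht, iInf_eq_top]
    intro j
    by_cases hj : j = i
    · exact h0 j (hj ▸ h) t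
    · exact h0 j (hd j hj) t
  · refine .inr ⟨h, fun t ht => ?_⟩
    rw [kerInter_cuboid hM ht]
    refine le_antisymm (iInf_le _ i) (le_iInf fun j => ?_)
    by_cases hj : j = i
    · rw [hj]
    · rw [h0 j (hd j hj)]; exact le_top

/-- A lift in `I⁺` need not lie in `K⁺`; its kernel components in the directions other than `i` are
at fault, and these die at `t`, so they can be dropped. -/
theorem exists_imInter_inf_kerInter_lift (hM : M.StronglyExact₃) (hfin : M.IsPfd) {i : Fin 3}
    (hd : ∀ j, j ≠ i → (d j).upper = ∅) (hs : s ∈ cuboid c d) (ht : t ∈ cuboid c d) (h : s ≤ t)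
    {x : M.space t} (hx : x ∈ M.imInter (cuboid c d) t ⊓ M.kerInter (cuboid c d) t) :
    ∃ y ∈ M.imInter (cuboid c d) s ⊓ M.kerInter (cuboid c d) s, M.rho h y = x := by
  obtain ⟨y, hy, rfl⟩ := exists_imInter_lift hfin hs h hx.1
  rcases kerInter_eq_top_or_kPlus (c := c) hM hd with htop | ⟨hne, hk⟩
  · exact ⟨y, ⟨hy, by rw [htop s hs]; trivial⟩, rfl⟩
  obtain ⟨r, hr, hkr⟩ := exists_kPlus_eq_kr hfin i hne s
  have htr : t ≤ Function.update t i r := by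
    conv_lhs => rw [← Function.update_eq_self i t]
    exact update_monotone t i ((d i).lt_of_mem _ (ht i).2 r hr).le
  have huB : Function.update t i r ∉ cuboid c d := fun hB => by
    have := (hB i).2
    rw [Function.update_self] at this
    exact (d i).mem_lower_iff.1 this hr
  have h0 : y ∈ M.kr (Function.update t i r) s := by
    rw [M.kr_of_le (h.trans htr), LinearMap.mem_ker, ← M.rho_rho h htr]
    exact mem_kerInter.1 hx.2 _ huB htr
  -- The level `r` was chosen so that the `i`-component of this kernel is exactly `kPlus` at `s`.
  -- The remaining components involve only the coordinates of `t`.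
  rw [kr_eq_iSup hM, iSup_split_single _ i, Function.update_self, ← hkr] at h0
  obtain ⟨a, ha, b, hb, rfl⟩ := Submodule.mem_sup.1 h0
  have hbt : M.rho h b = 0 := by
    refine (iSup₂_le fun m hm => ?_ : _ ≤ LinearMap.ker (M.rho h)) hb
    rw [Function.update_of_ne hm, ← M.kr_of_le h]
    exact M.kr_mono s fun m' => by
      by_cases hm' : m' = m
      · subst hm'; simp
      · simpa [hm'] using h m'
  have hbi : b ∈ M.iPlus i (c i) s :=
    (iSup₂_le fun m hm => le_iInf₂ fun _ _ => kr_update_le_img_update hM hm s _ _ :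
      _ ≤ M.iPlus i (c i) s) hb
  refine ⟨a, ⟨?_, (hk s hs).ge ha⟩, by rw [map_add, hbt, add_zero]⟩
  rw [imInter_cuboid hM hs, Submodule.mem_iInf] at hy
  rw [SetLike.mem_coe, imInter_cuboid hM hs, Submodule.mem_iInf]
  intro j
  by_cases hj : j = i
  · subst hj
    have := sub_mem (hy j) hbi
    rwa [add_sub_cancel_right] at this
  · exact kPlus_le_iPlus hM (Ne.symm hj) hne ha

/-- The `i`-part of `K⁻` is absorbed into `K⁺`. The other parts lie in `I⁺` in direction `i`, while
`kPlus` in direction `i` lies in `I⁺` in the others; so both summands of an element of `V⁺` stay in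
`I⁺`. -/
theorem vPlus_le_sup_vMinus (hM : M.StronglyExact₃) {i : Fin 3}
    (hd : ∀ j, j ≠ i → (d j).upper = ∅) (ht : t ∈ cuboid c d) :
    M.vPlus (cuboid c d) t ≤
      (M.imInter (cuboid c d) t ⊓ M.kerInter (cuboid c d) t) ⊔ M.vMinus (cuboid c d) t := by
  rcases kerInter_eq_top_or_kPlus (c := c) hM hd with htop | ⟨hne, hk⟩
  · rw [htop t ht, inf_top_eq]
    exact (inf_le_left : M.vPlus (cuboid c d) t ≤ M.imInter (cuboid c d) t).trans le_sup_left
  intro x hx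
  have hxi := (imInter_cuboid hM ht).le hx.1
  rw [Submodule.mem_iInf] at hxi
  obtain ⟨κ, hκ, n, hn, hx₁⟩ := Submodule.mem_sup.1 hx.2
  have hn := (kerSum_cuboid hM ht).le hn
  rw [iSup_split_single _ i] at hn
  obtain ⟨n', hn', b, hb, hx₂⟩ := Submodule.mem_sup.1 hn
  have hbi : b ∈ M.iPlus i (c i) t :=
    (iSup₂_le fun m hm => kMinus_le_iPlus hM hm :
      ⨆ m, ⨆ (_ : m ≠ i), M.kMinus m (d m) t ≤ M.iPlus i (c i) t) hb
  have hbk : b ∈ M.kerSum (cuboid c d) t := by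
    rw [kerSum_cuboid hM ht]
    exact (iSup₂_le fun m _ => le_iSup (fun m => M.kMinus m (d m) t) m :
      ⨆ m, ⨆ (_ : m ≠ i), M.kMinus m (d m) t ≤ ⨆ m, M.kMinus m (d m) t) hb
  have hxb : κ + n' = x - b := by rw [← hx₁, ← hx₂]; abel
  have ha : κ + n' ∈ M.kPlus i (d i) t := add_mem ((hk t ht).le hκ) (kMinus_le_kPlus hn')
  have hai : κ + n' ∈ M.imInter (cuboid c d) t := by
    rw [imInter_cuboid hM ht, Submodule.mem_iInf]
    intro j
    by_cases hj : j = i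
    · subst hj
      rw [hxb]
      exact sub_mem (hxi j) hbi
    · exact kPlus_le_iPlus hM (Ne.symm hj) hne ha
  have hbx : b = x - (κ + n') := by rw [hxb]; abel
  refine Submodule.mem_sup.2 ⟨κ + n', ⟨hai, (hk t ht).ge ha⟩, b, Submodule.mem_sup_left ⟨?_, hbk⟩,
    by rw [hxb, sub_add_cancel]⟩
  rw [hbx]
  exact sub_mem hx.1 hai

end Maps

end PersistenceModule

/-! ### Admissible complements: existence and their values at a point. -/

namespace PersistenceModule

section Complement

variable {k : Type u} [Field k] {M : PersistenceModule.{u, w} k (Fin 3 → ℝ)}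
  {c d : Fin 3 → RealCut} {s t : Fin 3 → ℝ} {i : Fin 3}

theorem exists_mem_limitOver (hM : M.StronglyExact₃) (hfin : M.IsPfd)
    (hd : ∀ j, j ≠ i → (d j).upper = ∅) (ht : t ∈ cuboid c d) {x : M.space t}
    (hx : x ∈ M.imInter (cuboid c d) t ⊓ M.kerInter (cuboid c d) t) :
    ∃ y ∈ M.limitOver (cuboid c d) (fun t => M.imInter (cuboid c d) t ⊓ M.kerInter (cuboid c d) t),
      y ⟨t, ht⟩ = x := by
  have : IsCodirectedOrder (cuboid c d) :=
    ⟨fun a b => ⟨⟨a.1 ⊓ b.1, inf_mem_cuboid a.2 b.2⟩,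
      (inf_le_left : a.1 ⊓ b.1 ≤ a.1), (inf_le_right : a.1 ⊓ b.1 ≤ b.1)⟩⟩
  have hfd : ∀ s : cuboid c d, FiniteDimensional k (M.space s.1) := fun s => hfin s.1
  obtain ⟨y, hy, hyt⟩ := exists_compatible_family_of_surjective (k := k) (ι := cuboid c d)
    (fun s => ↥(M.imInter (cuboid c d) s.1 ⊓ M.kerInter (cuboid c d) s.1))
    (fun s t h => (M.rho h).restrict fun x hx =>
      ⟨map_imInter_le s.2 h ⟨x, hx.1, rfl⟩, map_kerInter_le _ h ⟨x, hx.2, rfl⟩⟩)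
    (fun s x => Subtype.ext (M.rho_refl _ _))
    (fun s t u h h' x => Subtype.ext (M.rho_rho _ _ _))
    (fun s t h x => by
      obtain ⟨y, hy, hyx⟩ := exists_imInter_inf_kerInter_lift hM hfin hd s.2 t.2 h x.2
      exact ⟨⟨y, hy⟩, Subtype.ext hyx⟩)
    ⟨t, ht⟩ ⟨x, hx⟩
  exact ⟨fun s => (y s).1, ⟨fun s => (y s).2, fun s t h => congrArg Subtype.val (hy s t h)⟩,
    congrArg Subtype.val hyt⟩

/-- Membership in `V⁻` at one point is reflected down to the meet with any other point and then
pushed up to that point. -/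
theorem mem_limVMinus_of_apply_mem (hM : M.StronglyExact₃) (ht : t ∈ cuboid c d)
    {x : (t : cuboid c d) → M.space t.1} (hx : x ∈ M.limVPlus (cuboid c d))
    (hxt : x ⟨t, ht⟩ ∈ M.vMinus (cuboid c d) t) : x ∈ M.limVMinus (cuboid c d) := by
  refine ⟨fun s => ?_, hx.2⟩
  have hq := inf_mem_cuboid s.2 ht
  have h1 : x ⟨s.1 ⊓ t, hq⟩ ∈ M.vMinus (cuboid c d) (s.1 ⊓ t) := by
    refine mem_vMinus_of_rho_mem hM hq ht inf_le_right (hx.1 ⟨_, hq⟩) ?_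
    rwa [hx.2 ⟨_, hq⟩ ⟨t, ht⟩ inf_le_right]
  rw [← hx.2 ⟨_, hq⟩ s inf_le_left]
  exact map_vMinus_le hq s.2 inf_le_left ⟨_, h1, rfl⟩

theorem limitOver_mono {B : Set (Fin 3 → ℝ)} {V V' : (t : Fin 3 → ℝ) → Submodule k (M.space t)}
    (h : ∀ t, V t ≤ V' t) : M.limitOver B V ≤ M.limitOver B V' :=
  fun _ hx => ⟨fun t => h _ (hx.1 t), hx.2⟩

theorem limitOver_sup_limVMinus (hM : M.StronglyExact₃) (hfin : M.IsPfd)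
    (hd : ∀ j, j ≠ i → (d j).upper = ∅) :
    M.limitOver (cuboid c d) (fun t => M.imInter (cuboid c d) t ⊓ M.kerInter (cuboid c d) t) ⊔
      M.limVMinus (cuboid c d) = M.limVPlus (cuboid c d) := by
  have hL : M.limitOver (cuboid c d)
      (fun t => M.imInter (cuboid c d) t ⊓ M.kerInter (cuboid c d) t) ≤ M.limVPlus (cuboid c d) :=
    limitOver_mono fun t => inf_le_inf_left _ le_sup_left
  refine le_antisymm (sup_le hL (limitOver_mono (vMinus_le_vPlus _))) fun x hx => ?_
  rcases (cuboid c d).eq_empty_or_nonempty with h | ⟨t, ht⟩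
  · have : IsEmpty (cuboid c d) := Set.isEmpty_coe_sort.2 h
    rw [Subsingleton.elim x 0]
    exact zero_mem _
  · obtain ⟨l, hl, v, hv, hlv⟩ := Submodule.mem_sup.1 (vPlus_le_sup_vMinus hM hd ht (hx.1 ⟨t, ht⟩))
    obtain ⟨y, hy, hyt⟩ := exists_mem_limitOver hM hfin hd ht hl
    refine Submodule.mem_sup.2 ⟨y, hy, x - y, ?_, by abel⟩
    refine mem_limVMinus_of_apply_mem hM ht (sub_mem hx (hL hy)) ?_
    rw [Pi.sub_apply, hyt, ← hlv, add_sub_cancel_left]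
    exact hv

/-- Families with values in `I⁺ ∩ K⁺` represent all of `V⁺` modulo `V⁻` and vanish on leaving the
cuboid. Any complement taken among them therefore spans a submodule. -/
theorem exists_isBlockComplement (hM : M.StronglyExact₃) (hfin : M.IsPfd)
    (hd : ∀ j, j ≠ i → (d j).upper = ∅) : ∃ M0, M.IsBlockComplement (cuboid c d) M0 := by
  set A := M.limitOver (cuboid c d)
    (fun t => M.imInter (cuboid c d) t ⊓ M.kerInter (cuboid c d) t) with hA
  set N := M.limVMinus (cuboid c d) with hN
  have hAN : A ⊔ N = M.limVPlus (cuboid c d) := limitOver_sup_limVMinus hM hfin hd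
  -- The complement is taken in the whole product; by modularity `C ⊓ A` is a complement of `A ⊓ N`
  -- in `A`.
  obtain ⟨C, hC⟩ := exists_isCompl (A ⊓ N)
  refine ⟨C ⊓ A, ?_, ?_, ?_⟩
  · rw [inf_assoc, inf_comm]
    exact hC.inf_eq_bot
  · have h1 : A ≤ C ⊓ A ⊔ A ⊓ N := by
      have : (A ⊓ N ⊔ C) ⊓ A ≤ A ⊓ N ⊔ C ⊓ A :=
        (sup_inf_assoc_of_le C (inf_le_left : A ⊓ N ≤ A)).le
      rw [hC.sup_eq_top, top_inf_eq, sup_comm] at this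
      exact this
    rw [← hAN]
    exact le_antisymm (sup_le_sup_right inf_le_right _)
      (sup_le (h1.trans (sup_le_sup_left inf_le_right _)) le_sup_right)
  · intro s t h
    by_cases hs : s ∈ cuboid c d
    · rw [blockPart, dif_pos hs]
      rintro _ ⟨_, ⟨x, hx, rfl⟩, rfl⟩
      by_cases ht : t ∈ cuboid c d
      · rw [blockPart, dif_pos ht]
        exact ⟨x, hx, (hx.2.2 ⟨s, hs⟩ ⟨t, ht⟩ h).symm⟩
      · have : M.rho h (x ⟨s, hs⟩) = 0 := mem_kerInter.1 (hx.2.1 ⟨s, hs⟩).2 t ht h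
        rw [LinearMap.proj_apply, this]
        exact zero_mem _
    · rw [blockPart, dif_neg hs, Submodule.map_bot]
      exact bot_le

variable {M0 : Submodule k ((t : cuboid c d) → M.space t.1)}

theorem IsBlockComplement.blockPart_le (h0 : M.IsBlockComplement (cuboid c d) M0)
    (ht : t ∈ cuboid c d) : M.blockPart (cuboid c d) M0 t ≤ M.vPlus (cuboid c d) t := by
  rw [blockPart, dif_pos ht]
  rintro _ ⟨x, hx, rfl⟩
  exact (h0.sup_eq.le (Submodule.mem_sup_left hx)).1 ⟨t, ht⟩

theorem IsBlockComplement.eq_zero_of_mem (hM : M.StronglyExact₃)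
    (h0 : M.IsBlockComplement (cuboid c d) M0) (ht : t ∈ cuboid c d) {x : M.space t}
    (hx : x ∈ M.blockPart (cuboid c d) M0 t) (hx' : x ∈ M.vMinus (cuboid c d) t) : x = 0 := by
  rw [blockPart, dif_pos ht] at hx
  obtain ⟨y, hy, rfl⟩ := hx
  have := mem_limVMinus_of_apply_mem hM ht (h0.sup_eq.le (Submodule.mem_sup_left hy)) hx'
  have hy0 : y ∈ M0 ⊓ M.limVMinus (cuboid c d) := ⟨hy, this⟩
  rw [h0.inf_eq, Submodule.mem_bot] at hy0
  rw [hy0, map_zero]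

theorem IsBlockComplement.vPlus_le (hM : M.StronglyExact₃) (hfin : M.IsPfd)
    (hd : ∀ j, j ≠ i → (d j).upper = ∅)
    (h0 : M.IsBlockComplement (cuboid c d) M0) (ht : t ∈ cuboid c d) :
    M.vPlus (cuboid c d) t ≤ M.blockPart (cuboid c d) M0 t ⊔ M.vMinus (cuboid c d) t := by
  refine (vPlus_le_sup_vMinus hM hd ht).trans (sup_le ?_ le_sup_right)
  intro x hx
  obtain ⟨y, hy, rfl⟩ := exists_mem_limitOver hM hfin hd ht hx
  have hy' : y ∈ M0 ⊔ M.limVMinus (cuboid c d) := by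
    rw [h0.sup_eq]
    exact limitOver_mono (fun t => inf_le_inf_left _ le_sup_left) hy
  obtain ⟨z, hz, v, hv, rfl⟩ := Submodule.mem_sup.1 hy'
  refine Submodule.add_mem_sup ?_ (hv.1 ⟨t, ht⟩)
  rw [blockPart, dif_pos ht]
  exact ⟨z, hz, rfl⟩

end Complement

end PersistenceModule

theorem LayerOrBirthBlock.exists_eq_cuboid (B : LayerOrBirthBlock) :
    ∃ (c d : Fin 3 → RealCut) (i : Fin 3), B.1 = cuboid c d ∧ ∀ j, j ≠ i → (d j).upper = ∅ := by
  obtain ⟨i, c, d, h, h', -⟩ | ⟨c, d, h, h'⟩ := B.2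
  · exact ⟨c, d, i, h, fun j hj => (h' j hj).2⟩
  · exact ⟨c, d, 0, h, fun j _ => h' j⟩

/-! ### Independence of the summands. -/

namespace PersistenceModule

section Independence

variable {k : Type u} [Field k] {M : PersistenceModule.{u, w} k (Fin 3 → ℝ)} {t : Fin 3 → ℝ}

theorem update_le_of_mem_lower {c d : Fin 3 → RealCut} (ht : t ∈ cuboid c d) {i : Fin 3} {r : ℝ}
    (hr : r ∈ (c i).lower) : Function.update t i r ≤ t ∧ Function.update t i r ∉ cuboid c d := by
  refine ⟨?_, fun hB => ?_⟩
  · conv_rhs => rw [← Function.update_eq_self i t]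
    exact update_monotone t i ((c i).lt_of_mem r hr _ (ht i).1).le
  · have := (hB i).1
    rw [Function.update_self] at this
    exact (c i).mem_upper_iff.1 this hr

/-- A strict layer omits a point below `t`, and `tilde` lies in every image. A birth block contains
everything above `t`, so all kernels at `t` count in its `K⁻`. -/
theorem tilde_le (B : LayerOrBirthBlock) (ht : t ∈ B.1) :
    M.tilde t ≤ M.imSum B.1 t ⊔ M.kerSum B.1 t := by
  obtain ⟨i, c, d, h, -, hc, -⟩ | ⟨c, d, h, hd⟩ := B.2
  · rw [h] at ht ⊢
    obtain ⟨r, hr⟩ := Set.nonempty_iff_ne_empty.2 hc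
    obtain ⟨hle, hn⟩ := update_le_of_mem_lower ht hr
    refine le_trans (fun x hx => ?_) le_sup_left
    exact range_le_imSum hn hle (mem_imInter.1 hx.1 _ trivial hle)
  · rw [h] at ht ⊢
    refine le_trans inf_le_right (le_trans ?_ le_sup_right)
    refine iSup_le fun u => iSup₂_le fun _ htu => ker_le_kerSum (fun j => ⟨?_, ?_⟩) htu
    · exact RealCut.mem_upper_of_le (ht j).1 (htu j)
    · rw [RealCut.lower_eq_univ (hd j)]; trivial

/-- A point `s` of `B'` outside `B` puts `I⁺` of `B'` into `I⁻` of `B`. A point `u` of `B` outside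
`B'` puts `K⁺` of `B'` into `K⁻` of `B`; here `K⁻` of `B'` must follow, which holds once `B'` above
`t` is contained in `B`. That is so if `B` is a birth block or both are layers in the same
direction. For layers in different directions a suitable `s` exists instead, and for `B'` a birth
block there is no such `u`. -/
theorem vPlus_le_of_exists (B B' : LayerOrBirthBlock) (ht : t ∈ B.1) (ht' : t ∈ B'.1)
    (h : (∃ s ∈ B'.1, s ∉ B.1 ∧ s ≤ t) ∨ ∃ u ∈ B.1, u ∉ B'.1 ∧ t ≤ u) :
    M.vPlus B'.1 t ≤ M.imSum B.1 t ⊔ M.kerSum B.1 t := by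
  have low : (∃ s ∈ B'.1, s ∉ B.1 ∧ s ≤ t) → M.vPlus B'.1 t ≤ M.imSum B.1 t ⊔ M.kerSum B.1 t := by
    rintro ⟨s, hs', hs, hst⟩
    refine le_trans (fun x hx => ?_) le_sup_left
    exact range_le_imSum hs hst (mem_imInter.1 hx.1 _ hs' hst)
  have high : (∃ u ∈ B.1, u ∉ B'.1 ∧ t ≤ u) → (∀ u ∈ B'.1, t ≤ u → u ∈ B.1) →
      M.vPlus B'.1 t ≤ M.imSum B.1 t ⊔ M.kerSum B.1 t := by
    rintro ⟨u, hu, hu', htu⟩ hB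
    refine le_trans inf_le_right (le_trans (sup_le ?_ ?_) le_sup_right)
    · exact fun x hx => ker_le_kerSum hu htu (mem_kerInter.1 hx u hu' htu)
    · exact iSup_le fun v => iSup₂_le fun hv htv => ker_le_kerSum (hB v hv htv) htv
  rcases h with h | h
  · exact low h
  obtain ⟨i, c, d, hB, hcd, hc, hd⟩ | ⟨c, d, hB, hd⟩ := B.2
  · obtain ⟨i', c', d', hB', hcd', hc', hd'⟩ | ⟨c', d', hB', hd'⟩ := B'.2
    · by_cases hi : i = i'
      · subst hi
        refine high h fun v hv htv => ?_
        obtain ⟨u, hu, hu', htu⟩ := h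
        rw [hB] at ht hu ⊢
        rw [hB'] at ht' hu' hv
        have hui : u i ∈ (d' i).upper := by
          by_contra hui
          refine hu' fun j => ⟨RealCut.mem_upper_of_le (ht' j).1 (htu j), ?_⟩
          by_cases hj : j = i
          · rw [hj]; exact (d' i).mem_lower_iff.2 hui
          · rw [RealCut.lower_eq_univ (hcd' j hj).2]; trivial
        intro j
        refine ⟨RealCut.mem_upper_of_le (ht j).1 (htv j), ?_⟩
        by_cases hj : j = i
        · rw [hj]
          exact RealCut.mem_lower_of_le (hu i).2 ((d' i).lt_of_mem _ (hv i).2 _ hui).le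
        · rw [RealCut.lower_eq_univ (hcd j hj).2]; trivial
      · refine low ?_
        obtain ⟨r, hr⟩ := Set.nonempty_iff_ne_empty.2 hc
        rw [hB] at ht ⊢
        rw [hB'] at ht' ⊢
        obtain ⟨hle, hn⟩ := update_le_of_mem_lower ht hr
        refine ⟨_, update_mem_cuboid ht' ?_, hn, hle⟩
        rw [RealCut.upper_eq_univ (hcd' i hi).1, RealCut.lower_eq_univ (hcd' i hi).2]
        trivial
    · obtain ⟨u, hu, hu', htu⟩ := h
      rw [hB'] at ht' hu'
      exact absurd (fun j => ⟨RealCut.mem_upper_of_le (ht' j).1 (htu j),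
        by rw [RealCut.lower_eq_univ (hd' j)]; trivial⟩) hu'
  · refine high h fun v _ htv => ?_
    rw [hB] at ht ⊢
    exact fun j => ⟨RealCut.mem_upper_of_le (ht j).1 (htv j),
        by rw [RealCut.lower_eq_univ (hd j)]; trivial⟩

theorem LayerOrBirthBlock.mem_iff (B : LayerOrBirthBlock) (ht : t ∈ B.1) (p : Fin 3 → ℝ) :
    p ∈ B.1 ↔ p ⊓ t ∈ B.1 ∧ p ⊔ t ∈ B.1 := by
  obtain ⟨c, d, i, h, -⟩ := B.exists_eq_cuboid
  rw [h] at ht ⊢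
  refine ⟨fun hp => ⟨inf_mem_cuboid hp ht, sup_mem_cuboid hp ht⟩, fun ⟨h1, h2⟩ j => ?_⟩
  exact ⟨RealCut.mem_upper_of_le (h1 j).1 inf_le_left, RealCut.mem_lower_of_le (h2 j).2 le_sup_left⟩

theorem iSupIndep_blockPart (hM : M.StronglyExact₃)
    {M0 : (B : LayerOrBirthBlock) → Submodule k ((t : B.1) → M.space t.1)}
    (h0 : ∀ B, M.IsBlockComplement B.1 (M0 B)) {N : Option LayerOrBirthBlock → Submodule k (M.space t)}
    (hnone : N none = M.tilde t) (hsome : ∀ B, N (some B) = M.blockPart B.1 (M0 B) t) :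
    iSupIndep N := by
  classical
  rw [iSupIndep_iff_finsetSum_eq_zero_imp_eq_zero]
  intro F v hv hsum
  have hmem : ∀ B, some B ∈ F → v (some B) ∈ M.blockPart B.1 (M0 B) t := fun B hB =>
    hsome B ▸ hv _ hB
  have hne : ∀ B, some B ∈ F → v (some B) ≠ 0 → t ∈ B.1 := fun B hB hB0 => by
    by_contra ht
    have := hmem B hB
    rw [blockPart, dif_neg ht] at this
    exact hB0 this
  -- the blocks that contribute a nonzero summand
  set S : Finset LayerOrBirthBlock := (F.filter fun o => v o ≠ 0).eraseNone with hS
  have hmemS : ∀ B, B ∈ S ↔ some B ∈ F ∧ v (some B) ≠ 0 := fun B => by simp [hS]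
  have hSe : S = ∅ := by
    by_contra hSne
    -- If neither alternative of `vPlus_le_of_exists` held for another contributing `B'`, then `B ≤
    -- B'` in this order. Maximality would give equal parts below and above `t`, which determine a
    -- block containing `t`.
    obtain ⟨B, hBmax⟩ := S.exists_maximalFor (fun B : LayerOrBirthBlock =>
      ((OrderDual.toDual (B.1 ∩ Set.Iic t), B.1 ∩ Set.Ici t) :
        (Set (Fin 3 → ℝ))ᵒᵈ × Set (Fin 3 → ℝ))) (Finset.nonempty_iff_ne_empty.2 hSne)
    obtain ⟨hBF, hB0⟩ := (hmemS B).1 hBmax.1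
    have htB := hne B hBF hB0
    have hrest : v (some B) ∈ M.imSum B.1 t ⊔ M.kerSum B.1 t := by
      rw [← Finset.add_sum_erase _ _ hBF] at hsum
      rw [eq_neg_of_add_eq_zero_left hsum]
      refine neg_mem (sum_mem fun o ho => ?_)
      obtain ⟨hoB, hoF⟩ := Finset.mem_erase.1 ho
      rcases o with _ | B'
      · exact tilde_le B htB (hnone ▸ hv _ hoF)
      by_cases hv0 : v (some B') = 0
      · rw [hv0]; exact zero_mem _
      have htB' := hne B' hoF hv0
      have hle : M.blockPart B'.1 (M0 B') t ≤ M.vPlus B'.1 t := by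
        obtain ⟨c, d, i, h, -⟩ := B'.exists_eq_cuboid
        obtain ⟨B', hB'⟩ := B'
        subst h
        exact (h0 ⟨_, hB'⟩).blockPart_le htB'
      refine vPlus_le_of_exists B B' htB htB' ?_ (hle (hmem B' hoF))
      by_contra! hcon
      have hle' : ((OrderDual.toDual (B.1 ∩ Set.Iic t), B.1 ∩ Set.Ici t) :
          (Set (Fin 3 → ℝ))ᵒᵈ × Set (Fin 3 → ℝ)) ≤
          (OrderDual.toDual (B'.1 ∩ Set.Iic t), B'.1 ∩ Set.Ici t) :=
        ⟨fun s hs => ⟨by_contra fun h => hcon.1 s hs.1 h hs.2, hs.2⟩,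
          fun u hu => ⟨by_contra fun h => hcon.2 u hu.1 h hu.2, hu.2⟩⟩
      have hge := hBmax.2 ((hmemS B').2 ⟨hoF, hv0⟩) hle'
      refine hoB (congrArg some (Subtype.ext (Set.ext fun p => ?_)))
      rw [LayerOrBirthBlock.mem_iff B' htB', LayerOrBirthBlock.mem_iff B htB]
      refine and_congr ⟨fun h => ?_, fun h => ?_⟩ ⟨fun h => ?_, fun h => ?_⟩
      · exact (hle'.1 ⟨h, Set.mem_Iic.2 inf_le_right⟩).1
      · exact (hge.1 ⟨h, Set.mem_Iic.2 inf_le_right⟩).1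
      · exact (hge.2 ⟨h, Set.mem_Ici.2 le_sup_right⟩).1
      · exact (hle'.2 ⟨h, Set.mem_Ici.2 le_sup_right⟩).1
    have hB := hmem B hBF
    obtain ⟨c, d, i, h, -⟩ := B.exists_eq_cuboid
    apply hB0
    generalize v (some B) = x at hrest hB
    clear hBmax hBF hB0
    obtain ⟨B, hB'⟩ := B
    subst h
    exact (h0 ⟨_, hB'⟩).eq_zero_of_mem hM htB hB
      (vPlus_inf_le_vMinus hM htB ⟨(h0 ⟨_, hB'⟩).blockPart_le htB hB, hrest⟩)
  have hzero : ∀ B, some B ∈ F → v (some B) = 0 := fun B hB => by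
    by_contra h
    have := (hmemS B).2 ⟨hB, h⟩
    rw [hSe] at this
    simp at this
  intro o ho
  rcases o with _ | B
  · rwa [Finset.sum_eq_single_of_mem none ho] at hsum
    rintro (_ | B) hB hne
    · exact absurd rfl hne
    · exact hzero B hB
  · exact hzero B ho

end Independence

end PersistenceModule

/-- The cut whose upper part consists of the points where a monotone function is at least `a`. -/
def RealCut.ofMonotone {α : Type*} [Preorder α] {f : ℝ → α} (hf : Monotone f) (a : α) : RealCut where
  lower := {r | ¬ a ≤ f r}
  upper := {r | a ≤ f r}
  isCompl := (isCompl_compl (x := {r | a ≤ f r})).symm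
  lt_of_mem := fun _ hx _ hy => lt_of_not_ge fun h => hx (le_trans hy (hf h))

/-! ### The summands span. -/

namespace PersistenceModule

section Span

variable {k : Type u} [Field k] {M : PersistenceModule.{u, w} k (Fin 3 → ℝ)} {t : Fin 3 → ℝ}

theorem mem_tilde (hM : M.StronglyExact₃) {x : M.space t} :
    x ∈ M.tilde t ↔ (∀ i, x ∈ M.iPlus i RealCut.atBot t) ∧ x ∈ ⨆ i, M.kMinus i RealCut.atTop t := by
  have ht : t ∈ cuboid (fun _ => RealCut.atBot) (fun _ => RealCut.atTop) := by
    rw [← univ_eq_cuboid]; trivial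
  rw [tilde, imPlus, kerMinus, univ_eq_cuboid, imInter_cuboid hM ht, kerSum_cuboid hM ht,
    Submodule.mem_inf, Submodule.mem_iInf]

theorem kMinus_le_kMinus_atTop (i : Fin 3) (d : RealCut) :
    M.kMinus i d t ≤ M.kMinus i RealCut.atTop t :=
  iSup₂_le fun r _ => le_iSup₂_of_le r (Set.mem_univ r) le_rfl

theorem img_update_self (i : Fin 3) : M.img (Function.update t i (t i)) t = ⊤ :=
  M.img_eq_top (by rw [Function.update_eq_self])

theorem kr_update_self (i : Fin 3) : M.kr (Function.update t i (t i)) t = ⊥ :=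
  M.kr_eq_bot (by rw [Function.update_eq_self])

theorem finrank_lt_of_monotone (hfin : M.IsPfd) {f : ℝ → Submodule k (M.space t)} (hf : Monotone f)
    {r a : ℝ} (hr : ¬ f a ≤ f r) : Module.finrank k (f r) < Module.finrank k (f a) := by
  have := hfin t
  have h : r ≤ a := le_of_not_ge fun h => hr (hf h)
  exact Submodule.finrank_lt_finrank_of_lt ((hf h).lt_of_not_ge hr)

variable {S : Submodule k (M.space t)}

/-- If `S` contains `tilde` and complements of `V⁻` in `V⁺` for all blocks, then it contains the part
of `M_t` that dies in the `i`-th direction. -/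
theorem kr_inf_img_le (hM : M.StronglyExact₃) (hfin : M.IsPfd) (hS₀ : M.tilde t ≤ S)
    (hS : ∀ B : LayerOrBirthBlock, t ∈ B.1 → M.vPlus B.1 t ≤ S ⊔ M.vMinus B.1 t)
    (i : Fin 3) (u a : ℝ) :
    M.kr (Function.update t i u) t ⊓ M.img (Function.update t i a) t ≤ S := by
  suffices H : ∀ (n : ℕ) (u a : ℝ), Module.finrank k (M.kr (Function.update t i u) t) +
      Module.finrank k (M.img (Function.update t i a) t) < n →
      M.kr (Function.update t i u) t ⊓ M.img (Function.update t i a) t ≤ S from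
    H _ u a (Nat.lt_succ_self _)
  intro n
  induction n with
  | zero => intro u a h; exact absurd h (Nat.not_lt_zero _)
  | succ n ih =>
  intro u a hn x hx
  by_cases hu : M.kr (Function.update t i u) t ≤ ⊥
  · rw [(Submodule.mem_bot k).1 (hu hx.1)]
    exact zero_mem _
  -- The cuts sit where the image first reaches the one at `a` and the kernel first reaches the one
  -- at `u`. Levels strictly below them thus give subspaces of strictly smaller dimension.
  set c₁ := RealCut.ofMonotone (monotone_img_update (M := M) i t) (M.img (Function.update t i a) t)
    with hc₁
  set d₁ := RealCut.ofMonotone (monotone_kr_update (M := M) i t) (M.kr (Function.update t i u) t)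
    with hd₁
  have hac : a ∈ c₁.upper := le_rfl (a := M.img (Function.update t i a) t)
  have hud : u ∈ d₁.upper := le_rfl (a := M.kr (Function.update t i u) t)
  have htc : t i ∈ c₁.upper := by
    change _ ≤ M.img (Function.update t i (t i)) t
    rw [img_update_self]; exact le_top
  have htd : t i ∈ d₁.lower := by
    change ¬ _ ≤ M.kr (Function.update t i (t i)) t
    rwa [kr_update_self]
  have hxj : ∀ j, j ≠ i → x ∈ M.iPlus j RealCut.atBot t := fun j hj =>
    mem_iPlus.2 fun r _ => kr_update_le_img_update hM hj.symm t u r hx.1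
  -- With no level below the cut, `x` lies in every image in direction `i`, and as a kernel element
  -- also in those of the other directions; so `x ∈ tilde`.
  rcases c₁.lower.eq_empty_or_nonempty with hc | hc
  · refine hS₀ ((mem_tilde hM).2 ⟨fun j => ?_, ?_⟩)
    · by_cases hj : j = i
      · subst hj
        refine mem_iPlus.2 fun r _ => ?_
        have hr : r ∈ c₁.upper := by rw [RealCut.upper_eq_univ hc]; trivial
        exact hr hx.2
      · exact hxj j hj
    · exact Submodule.mem_iSup_of_mem i (mem_kMinus.2 (.inr ⟨u, trivial, hx.1⟩))
  set c : Fin 3 → RealCut := Function.update (fun _ => RealCut.atBot) i c₁ with hcdef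
  set d : Fin 3 → RealCut := Function.update (fun _ => RealCut.atTop) i d₁ with hddef
  have hci : c i = c₁ := Function.update_self ..
  have hdi : d i = d₁ := Function.update_self ..
  have hcj : ∀ j, j ≠ i → c j = RealCut.atBot := fun j hj => Function.update_of_ne hj ..
  have hdj : ∀ j, j ≠ i → d j = RealCut.atTop := fun j hj => Function.update_of_ne hj ..
  have ht : t ∈ cuboid c d := fun j => by
    by_cases hj : j = i
    · rw [hj, hci, hdi]; exact ⟨htc, htd⟩
    · rw [hcj j hj, hdj j hj]; exact ⟨trivial, trivial⟩
  have hB : IsLayerBlock i (cuboid c d) := by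
    refine ⟨c, d, rfl, fun j hj => ?_, ?_, ?_⟩
    · rw [hcj j hj, hdj j hj]; exact ⟨rfl, rfl⟩
    · rw [hci]; exact Set.nonempty_iff_ne_empty.1 hc
    · rw [hdi]; exact Set.nonempty_iff_ne_empty.1 ⟨u, hud⟩
  -- the contributions of the kernels in the other directions lie in `tilde`
  have rest : ∀ v ∈ M.imInter (cuboid c d) t, ∀ n ∈ M.kPlus i d₁ t,
      ∀ b ∈ ⨆ m, ⨆ (_ : m ≠ i), M.kMinus m (d m) t, n + b = v → b ∈ S := by
    intro v hv n hn b hb hnb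
    rw [imInter_cuboid hM ht, Submodule.mem_iInf] at hv
    refine hS₀ ((mem_tilde hM).2 ⟨fun j => ?_, ?_⟩)
    · by_cases hj : j = i
      · subst hj
        exact (iSup₂_le fun m hm => kMinus_le_iPlus hM hm :
          ⨆ m, ⨆ (_ : m ≠ j), M.kMinus m (d m) t ≤ M.iPlus j RealCut.atBot t) hb
      · rw [eq_sub_of_add_eq' hnb]
        exact sub_mem (hcj j hj ▸ hv j) (kPlus_le_iPlus hM (Ne.symm hj) ⟨u, hud⟩ hn)
    · exact (iSup₂_le fun m _ => (kMinus_le_kMinus_atTop m (d m)).trans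
        (le_iSup (fun m => M.kMinus m RealCut.atTop t) m) :
        ⨆ m, ⨆ (_ : m ≠ i), M.kMinus m (d m) t ≤ ⨆ m, M.kMinus m RealCut.atTop t) hb
  have hk : M.kerInter (cuboid c d) t = M.kPlus i d₁ t := by
    rcases kerInter_eq_top_or_kPlus (c := c) hM (i := i) (d := d)
      (fun j hj => by rw [hdj j hj]; rfl) with h | h
    · have h1 := kerInter_cuboid hM ht
      rw [h t ht, eq_comm, iInf_eq_top] at h1
      rw [h t ht, ← hdi, h1 i]
    · rw [h.2 t ht, hdi]
  have hxV : x ∈ M.vPlus (cuboid c d) t := by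
    refine ⟨(imInter_cuboid hM ht).ge ((Submodule.mem_iInf _).2 fun j => ?_),
      Submodule.mem_sup_left (hk.ge (mem_kPlus.2 fun r hr => hr hx.1))⟩
    by_cases hj : j = i
    · rw [hj, hci]; exact mem_iPlus.2 fun r hr => hr hx.2
    · rw [hcj j hj]; exact hxj j hj
  obtain ⟨m, hm, v, hv, rfl⟩ := Submodule.mem_sup.1 (hS ⟨_, .inl ⟨i, hB⟩⟩ ht hxV)
  refine add_mem hm ?_
  obtain ⟨v₁, hv₁, v₂, hv₂, rfl⟩ := Submodule.mem_sup.1 hv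
  refine add_mem ?_ ?_
  -- The part in `Im⁺ ∩ Ker⁻`: modulo `tilde` it lies in a strictly smaller kernel, within the same
  -- image.
  · have h1 := (kerSum_cuboid hM ht).le hv₁.2
    rw [iSup_split_single _ i, hdi] at h1
    obtain ⟨n₁, hn₁, b, hb, hnb⟩ := Submodule.mem_sup.1 h1
    have hbS := rest v₁ hv₁.1 n₁ (kMinus_le_kPlus hn₁) b hb hnb
    rw [← hnb]
    refine add_mem ?_ hbS
    have hbi : b ∈ M.iPlus i c₁ t := (iSup₂_le fun m hm => kMinus_le_iPlus hM hm :
      ⨆ m, ⨆ (_ : m ≠ i), M.kMinus m (d m) t ≤ M.iPlus i c₁ t) hb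
    have hvi : v₁ ∈ M.iPlus i c₁ t := hci ▸ (Submodule.mem_iInf _).1
      ((imInter_cuboid hM ht).le hv₁.1) i
    have hni : n₁ ∈ M.img (Function.update t i a) t := by
      rw [eq_sub_of_add_eq hnb]
      exact mem_iPlus.1 (sub_mem hvi hbi) a hac
    rcases mem_kMinus.1 hn₁ with rfl | ⟨r, hr, hnr⟩
    · exact zero_mem _
    · refine ih r a ?_ ⟨hnr, hni⟩
      have := finrank_lt_of_monotone hfin (monotone_kr_update (M := M) i t) (r := r) (a := u) hr
      omega
  -- The part in `Im⁻ ∩ Ker⁺`: modulo `tilde` it lies in a strictly smaller image, within the same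
  -- kernel.
  · obtain ⟨κ, hκ, n, hn, hκn⟩ := Submodule.mem_sup.1 hv₂.2
    have h1 := (kerSum_cuboid hM ht).le hn
    rw [iSup_split_single _ i, hdi] at h1
    obtain ⟨n₁, hn₁, b, hb, hnb⟩ := Submodule.mem_sup.1 h1
    have hsum : (κ + n₁) + b = v₂ := by rw [add_assoc, hnb, hκn]
    have hκ' : κ + n₁ ∈ M.kPlus i d₁ t := add_mem (hk.le hκ) (kMinus_le_kPlus hn₁)
    have hbS := rest v₂ hv₂.1.2 _ hκ' b hb hsum
    rw [← hsum]
    refine add_mem ?_ hbS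
    have hbi : b ∈ M.iMinus i c₁ t := (iSup₂_le fun m hm => kMinus_le_iMinus hM hm hc :
      ⨆ m, ⨆ (_ : m ≠ i), M.kMinus m (d m) t ≤ M.iMinus i c₁ t) hb
    have hle : M.imSum (cuboid c d) t ≤ M.iMinus i c₁ t := by
      rw [imSum_cuboid hM ht]
      refine iSup_le fun j => ?_
      by_cases hj : j = i
      · rw [hj, hci]
      · rw [hcj j hj, iMinus_eq_bot rfl]; exact bot_le
    have hni : κ + n₁ ∈ M.iMinus i c₁ t := by
      rw [eq_sub_of_add_eq hsum]
      exact sub_mem (hle hv₂.1.1) hbi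
    rcases mem_iMinus.1 hni with h0 | ⟨r, hr, hnr⟩
    · rw [h0]; exact zero_mem _
    · refine ih u r ?_ ⟨mem_kPlus.1 hκ' u hud, hnr⟩
      have := finrank_lt_of_monotone hfin (monotone_img_update (M := M) i t) (r := r) (a := a) hr
      omega

/-- Kernels at `t` are handled by `kr_inf_img_le`, taking `a = t i` so that the image condition is
empty. The rest is an induction over birth blocks on the sum of the three coordinate image
dimensions. -/
theorem img_le (hM : M.StronglyExact₃) (hfin : M.IsPfd) (hS₀ : M.tilde t ≤ S)
    (hS : ∀ B : LayerOrBirthBlock, t ∈ B.1 → M.vPlus B.1 t ≤ S ⊔ M.vMinus B.1 t)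
    (s : Fin 3 → ℝ) : M.img s t ≤ S := by
  have hK : ∀ i d, M.kMinus i d t ≤ S := fun i d => iSup₂_le fun r _ => by
    have := kr_inf_img_le hM hfin hS₀ hS i r (t i)
    rwa [img_update_self, inf_top_eq] at this
  suffices H : ∀ (n : ℕ) (s : Fin 3 → ℝ),
      ∑ j, Module.finrank k (M.img (Function.update t j (s j)) t) < n → M.img s t ≤ S from
    H _ s (Nat.lt_succ_self _)
  intro n
  induction n with
  | zero => intro s h; exact absurd h (Nat.not_lt_zero _)
  | succ n ih =>
  intro s hn x hx
  set c : Fin 3 → RealCut := fun i => RealCut.ofMonotone (monotone_img_update (M := M) i t)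
    (M.img (Function.update t i (s i)) t) with hc
  set d : Fin 3 → RealCut := fun _ => RealCut.atTop with hd
  have hsc : ∀ i, s i ∈ (c i).upper := fun i => le_rfl (a := M.img (Function.update t i (s i)) t)
  have ht : t ∈ cuboid c d := fun i => ⟨by
    change _ ≤ M.img (Function.update t i (t i)) t
    rw [img_update_self]; exact le_top, trivial⟩
  have hB : IsBirthBlock (cuboid c d) := ⟨c, d, rfl, fun _ => rfl⟩
  have hxV : x ∈ M.vPlus (cuboid c d) t := by
    refine ⟨(imInter_cuboid hM ht).ge ((Submodule.mem_iInf _).2 fun j => ?_),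
      Submodule.mem_sup_left ((kerInter_cuboid hM ht).ge ((Submodule.mem_iInf _).2 fun j => ?_))⟩
    · exact mem_iPlus.2 fun r hr => hr ((mem_img_iff hM).1 hx j)
    · exact mem_kPlus.2 fun r hr => absurd hr (Set.notMem_empty r)
  obtain ⟨m, hm, v, hv, rfl⟩ := Submodule.mem_sup.1 (hS ⟨_, .inr hB⟩ ht hxV)
  refine add_mem hm ?_
  obtain ⟨v₁, hv₁, v₂, hv₂, rfl⟩ := Submodule.mem_sup.1 hv
  refine add_mem ((iSup_le fun i => hK i _) ((kerSum_cuboid hM ht).le hv₁.2)) ?_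
  have hv₂s : v₂ ∈ M.img s t := (mem_img_iff hM).2 fun i =>
    mem_iPlus.1 ((Submodule.mem_iInf _).1 ((imInter_cuboid hM ht).le hv₂.1.2) i) _ (hsc i)
  -- Distributivity splits the image part of `V⁻` into elements that still come from `s` but with
  -- one coordinate lowered past its cut, which drops one of the three dimensions.
  refine (iSup_le fun i => ?_ : ⨆ i, M.img s t ⊓ M.iMinus i (c i) t ≤ S)
    (img_inf_iSup_iMinus_le hM hsc ⟨hv₂s, (imSum_cuboid hM ht).le hv₂.1.1⟩)
  rintro e ⟨hes, he⟩
  rcases mem_iMinus.1 he with rfl | ⟨r, hr, her⟩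
  · exact zero_mem _
  have hlt := finrank_lt_of_monotone hfin (monotone_img_update (M := M) i t) (r := r) (a := s i) hr
  refine ih (Function.update s i r) ?_ ?_
  · refine lt_of_lt_of_le (Finset.sum_lt_sum (fun j _ => ?_) ⟨i, Finset.mem_univ i, ?_⟩)
      (Nat.lt_succ_iff.1 hn)
    · by_cases hj : j = i
      · subst hj; rw [Function.update_self]; exact hlt.le
      · rw [Function.update_of_ne hj]
    · rw [Function.update_self]; exact hlt
  · rw [SetLike.mem_coe, mem_img_iff hM] at hes
    rw [mem_img_iff hM]
    intro j
    by_cases hj : j = i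
    · subst hj; rwa [Function.update_self]
    · rw [Function.update_of_ne hj]; exact hes j

end Span

theorem isPersistenceSubmodule_tilde {k : Type u} [Field k]
    (M : PersistenceModule.{u, w} k (Fin 3 → ℝ)) : M.IsPersistenceSubmodule M.tilde := by
  intro s t h
  have hu : ∀ p : Fin 3 → ℝ, p ∈ cuboid (fun _ => RealCut.atBot) (fun _ => RealCut.atTop) := by
    intro p; rw [← univ_eq_cuboid]; trivial
  unfold tilde
  rw [univ_eq_cuboid]
  exact (Submodule.map_inf_le _).trans (inf_le_inf (map_imInter_le (hu s) h) (map_kerSum_le (hu t) h))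

end PersistenceModule

/-! ### Assembly of the decomposition. -/

open PersistenceModule

theorem mainTheorem7 {k : Type u} [Field k] (M : PersistenceModule.{u, w} k (Fin 3 → ℝ))
    (hfin : M.IsPfd) (hexact : M.StronglyExact₃) :
    (∀ B : LayerOrBirthBlock, ∃ M0 : Submodule k ((t : B.1) → M.space t.1),
      M.IsBlockComplement B.1 M0) ∧
    ∀ M0 : (B : LayerOrBirthBlock) → Submodule k ((t : B.1) → M.space t.1),
      (∀ B, M.IsBlockComplement B.1 (M0 B)) →
      M.IsInternalDirectSum (fun o : Option LayerOrBirthBlock =>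
        match o with
        | none => M.tilde
        | some B => M.blockPart B.1 (M0 B)) := by
  refine ⟨fun B => ?_, fun M0 h0 => ⟨?_, fun t => ?_⟩⟩
  · obtain ⟨c, d, i, h, hd⟩ := B.exists_eq_cuboid
    rw [h]
    exact exists_isBlockComplement hexact hfin hd
  · rintro (_ | B)
    · exact M.isPersistenceSubmodule_tilde
    · exact (h0 B).isSubmodule
  · refine (@DirectSum.isInternal_submodule_iff_iSupIndep_and_iSup_eq_top k _ _
      (fun a b => Classical.propDecidable (a = b)) (M.space t) _ _ _).2
      ⟨iSupIndep_blockPart hexact h0 rfl fun _ => rfl, ?_⟩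
    set N : Option LayerOrBirthBlock → Submodule k (M.space t) := fun o =>
      (match o with
        | none => M.tilde
        | some B => M.blockPart B.1 (M0 B)) t with hN
    -- The whole space is the image from `t` itself, so spanning is the case `s = t` of `img_le`.
    rw [eq_top_iff, ← M.img_eq_top (le_refl t)]
    refine img_le hexact hfin (le_iSup N none) (fun B ht => ?_) t
    refine le_trans ?_ (sup_le_sup_right (le_iSup N (some B)) _)
    change _ ≤ M.blockPart B.1 (M0 B) t ⊔ _
    obtain ⟨c, d, i, h, hd⟩ := B.exists_eq_cuboid
    obtain ⟨B, hB⟩ := B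
    subst h
    exact (h0 ⟨_, hB⟩).vPlus_le hexact hfin hd ht
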